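/- **Notation.** For real $m\times m$ matrices let $\langle A,U\rangle=\mathrm{tr}(A^{\top}U)$ and let $\|\cdot\|_{S_p}$ be the Schatten-$p$ norm (the $\ell_p$ norm of the singular values). For $A_1,\dots,A_n\in\mathbb{R}^{m\times m}$ put $\mathcal{A}(U)=(\langle A_1,U\rangle,\dots,\langle A_n,U\rangle)\in\mathbb{R}^n$. Let $B_\infty^n=\{x\in\mathbb{R}^n:|x_i|\le 1\ \forall i\}$, and let $\mathcal{N}(K,L)$ be the least number of translates of $L$, with centers in $\mathbb{R}^n$, whose union contains $K$. For a function $\Phi$ differentiable on an open set $\mathcal{D}$ and $x,y\in\mathcal{D}$, let $D_\Phi(x,y)=\Phi(x)-\Phi(y)-\langle\nabla\Phi(y),x-y\rangle$ be the Bregman divergence. Consider one of the following two setups. * *Spectraplex setup:* $\|\cdot\|_*=\|\cdot\|_{S_1}$; $\mathcal{X}=\{X\succeq 0:\mathrm{tr}\,X=1\}$ is the set of symmetric positive semidefinite $m\times m$ matrices of trace one; $\mathcal{D}$ is the set of positive definite matrices, an open subset of the space of symmetric $m \times m$ matrices; and $\Phi(X)=\mathrm{tr}(X\log X)$. * *Schatten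 norm setup:* $\|\cdot\|_*=\|\cdot\|_{S_p}$ with $p\in(1,2]$; $\mathcal{X}=\mathcal{D}=\mathbb{R}^{m\times m}$; and $\Phi(X)=\frac{1}{2(p-1)}\|X\|_{S_p}^2$. **Lemma.** For every constant $C_0$ there is a constant $C$, depending only on $C_0$, such that the following holds in either setup, for all $n\ge 1$, all $m$ and (in the Schatten norm setup) all $p\in(1,2]$. Let $A_1,\dots,A_n\in\mathbb{R}^{m\times m}$ be symmetric with $\|A_i\|\le 1$ for all $i$, where $\|A\|=\sup\{\langle A,U\rangle:\|U\|_*\le 1\}$ (that is, the operator norm, respectively the Schatten-$\frac{p}{p-1}$ norm). Let $T_0,T'\subseteq\mathcal{X}\cap\mathcal{D}$ with $|T_0|\le 2^{C_0 n}$, and let $D_\Phi^{\max}\in\mathbb{R}$. If for every $U\in T'$ there is a $U_0\in T_0$ with $D_\Phi(U,U_0)\le D_\Phi^{\max}$, then $$\mathcal{N}\Big(\mathcal{A}(T'),\ \sqrt{\tfrac{D_\Phi^{\max}}{n}}\;B_\infty^n\Big)\le 2^{Cn}.$$ -/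

import Mathlib

open scoped Pointwise

noncomputable section

namespace MirrorCover

/-- Real `m × m` matrices. -/
abbrev Mat (m : ℕ) : Type := Matrix (Fin m) (Fin m) ℝ

/-- The real vector space of symmetric `m × m` matrices. -/
abbrev SymMat (m : ℕ) : Type := selfAdjoint.submodule ℝ (Mat m)

/-- The trace inner product `⟨A, U⟩ = tr (Aᵀ U)`. -/
def traceInner {m : ℕ} (A U : Mat m) : ℝ := (A.transpose * U).trace

/-- The Schatten-`p` norm: the `ℓ_p` norm of the `m` singular values. -/
def schattenNorm {m : ℕ} (p : ℝ) (X : Mat m) : ℝ :=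
  (∑ i : Fin m, (Matrix.toEuclideanLin X).singularValues i ^ p) ^ (1 / p)

/-- The dual `sup {⟨A, U⟩ : N U ≤ 1}` of a norm `N` on matrices. -/
def dualNorm {m : ℕ} (N : Mat m → ℝ) (A : Mat m) : ℝ :=
  sSup {r : ℝ | ∃ U : Mat m, N U ≤ 1 ∧ r = traceInner A U}

/-- The map `U ↦ (⟨A₁, U⟩, …, ⟨Aₙ, U⟩)`. -/
def measurementMap {m n : ℕ} (A : Fin n → Mat m) (U : Mat m) : Fin n → ℝ :=
  fun i => traceInner (A i) U

/-- The cube `{x : |x i| ≤ 1 for all i}`, the unit ball of the `ℓ_∞` norm. -/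
def unitCube (n : ℕ) : Set (Fin n → ℝ) := {x | ∀ i, |x i| ≤ 1}

/-- The least number of translates of `L` that cover `K` (`⊤` if no finite number does). -/
def coveringNumber {n : ℕ} (K L : Set (Fin n → ℝ)) : ℕ∞ :=
  ⨅ (S : Set (Fin n → ℝ)) (_ : K ⊆ ⋃ x ∈ S, x +ᵥ L), S.encard

/-- The Bregman divergence `Φ x - Φ y - ⟨∇Φ y, x - y⟩`. The linear form `⟨∇Φ y, ·⟩` is the
Fréchet derivative of `Φ` at `y`. -/
def bregman {E : Type*} [AddCommGroup E] [Module ℝ E] [TopologicalSpace E]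
    (Φ : E → ℝ) (x y : E) : ℝ :=
  Φ x - Φ y - fderiv ℝ Φ y (x - y)

/-- The spectraplex: positive semidefinite matrices of trace one. -/
def spectraplex (m : ℕ) : Set (SymMat m) :=
  {X | (X : Mat m).PosSemidef ∧ (X : Mat m).trace = 1}

/-- The positive definite matrices, an open subset of the symmetric ones. -/
def posDefMatrices (m : ℕ) : Set (SymMat m) := {X | (X : Mat m).PosDef}

/-- The entropy mirror map `tr (X log X)`; it is only evaluated near positive definite `X`. -/
def entropyMirrorMap {m : ℕ} (X : SymMat m) : ℝ :=
  ((X : Mat m) * cfc Real.log (X : Mat m)).trace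

/-- The Schatten mirror map `‖X‖_{S_p}² / (2 (p - 1))`, on all real `m × m` matrices. -/
def schattenMirrorMap {m : ℕ} (p : ℝ) (X : Mat m) : ℝ :=
  1 / (2 * (p - 1)) * schattenNorm p X ^ 2

end MirrorCover

end

noncomputable section

namespace MirrorCover

open scoped Matrix

/-! The cover comes from mirror descent run backwards: each target `U` is encoded by a short run
whose final iterate has nearly the same measurements as `U`. Fix `U₀` and let `V k` minimize `Φ -
⟨∇Φ(U₀), ·⟩ - ∑ j, k j * ⟨A j, ·⟩`. The potential `F k`, the gap of this tilted function between `U`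
and `V k`, equals the Bregman divergence of `U` from `V k` and starts below `D`. As long as some
measurement of `V k` is off by more than `ε = √(D / n)`, moving that coordinate of `k` by `± ε / 5`
lowers `F` by at least `ε² / 10`, so `10 n` steps exhaust the budget `D`. The state `k` is a sum of
steps, so the final iterate depends only on the multiset of steps. There are at most `2 ^ (12 n)`
multisets, whereas ordered sequences would cost an extra `log n` in the exponent. This is
`exists_small_net`; a union over `T₀` gives `C = C₀ + 12`.

The analytic input is strong convexity seen through a single measurement: the Bregman divergence of
`Y` from `X` is at least `⟨A, Y - X⟩² / 10` for `A` in the dual unit ball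
(`bregman_entropyMirrorMap_ge`, `bregman_schattenMirrorMap_ge`). No matrix Hessian is needed. In
eigenbases `U` of `M` and `V` of `N`, the squared overlaps `(Uᵀ V) i j ^ 2` are doubly stochastic,
and the Bregman divergence of a trace function is the average, with these weights, of scalar Bregman
divergences between eigenvalues (`sum_sub_sum_sub`). Scalar quadratic lower bounds then meet a
weighted Cauchy–Schwarz inequality for `tr (A (N - M))` (`trace_mul_sub_sq_le`). Non-symmetric
matrices in the Schatten setup are handled by their symmetric dilation. The same averaging identity
also proves differentiability. -/

/-- `M = U diag(x) Uᵀ` with `U` orthogonal. -/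
structure SpectralDecomp {ι : Type*} [Fintype ι] [DecidableEq ι]
    (U : Matrix ι ι ℝ) (x : ι → ℝ) (M : Matrix ι ι ℝ) : Prop where
  mul_transpose : U * Uᵀ = 1
  transpose_mul : Uᵀ * U = 1
  eq : M = U * Matrix.diagonal x * Uᵀ

/-! ### Pairs of eigenbases and their doubly stochastic overlaps -/

section Spectral

variable {ι : Type*} [Fintype ι] [DecidableEq ι]

theorem spectralDecomp_of_isHermitian {M : Matrix ι ι ℝ} (hH : M.IsHermitian) :
    SpectralDecomp (hH.eigenvectorUnitary : Matrix ι ι ℝ) hH.eigenvalues M := by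
  refine ⟨?_, ?_, ?_⟩
  · have := Unitary.coe_mul_star_self hH.eigenvectorUnitary
    rwa [Unitary.coe_star, Matrix.star_eq_conjTranspose,
      Matrix.conjTranspose_eq_transpose_of_trivial] at this
  · have := Unitary.coe_star_mul_self hH.eigenvectorUnitary
    rwa [Matrix.star_eq_conjTranspose, Matrix.conjTranspose_eq_transpose_of_trivial] at this
  · have := hH.spectral_theorem
    rw [Unitary.conjStarAlgAut_apply, Matrix.star_eq_conjTranspose,
      Matrix.conjTranspose_eq_transpose_of_trivial] at this
    exact this

theorem exists_spectralDecomp {M : Matrix ι ι ℝ} (hM : M.IsSymm) :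
    ∃ U x, SpectralDecomp U x M := by
  have hH : M.IsHermitian := by
    rw [Matrix.IsHermitian, Matrix.conjTranspose_eq_transpose_of_trivial]; exact hM
  exact ⟨_, _, spectralDecomp_of_isHermitian hH⟩

namespace SpectralDecomp

variable {U V : Matrix ι ι ℝ} {x y : ι → ℝ} {M N : Matrix ι ι ℝ}

theorem isSymm (h : SpectralDecomp U x M) : M.IsSymm := by
  rw [Matrix.IsSymm, h.eq]
  simp [Matrix.transpose_mul, Matrix.mul_assoc]

theorem mk' (h : SpectralDecomp U x M) (y : ι → ℝ) :
    SpectralDecomp U y (U * Matrix.diagonal y * Uᵀ) :=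
  ⟨h.mul_transpose, h.transpose_mul, rfl⟩

theorem roots_charpoly (h : SpectralDecomp U x M) :
    M.charpoly.roots = Finset.univ.val.map x := by
  have : M.charpoly = ∏ i, (Polynomial.X - Polynomial.C (x i)) := by
    rw [h.eq, Matrix.charpoly_mul_comm, ← mul_assoc, h.transpose_mul, one_mul,
      Matrix.charpoly_diagonal]
  rw [this, Polynomial.roots_prod]
  · simp
  · simp [Finset.prod_ne_zero_iff, Polynomial.X_sub_C_ne_zero]

/-- The right side sees only the characteristic polynomial, so spectral sums do not depend on the
chosen eigenbasis. -/
theorem sum_eq (h : SpectralDecomp U x M) (f : ℝ → ℝ) :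
    ∑ i, f (x i) = (M.charpoly.roots.map f).sum := by
  rw [h.roots_charpoly]; simp

theorem smul (h : SpectralDecomp U x M) (t : ℝ) :
    SpectralDecomp U (fun i => t * x i) (t • M) := by
  refine ⟨h.mul_transpose, h.transpose_mul, ?_⟩
  have : Matrix.diagonal (fun i => t * x i) = t • Matrix.diagonal x := by
    ext i j; simp [Matrix.diagonal_apply]
  rw [this, h.eq]; simp

theorem mul_self (h : SpectralDecomp U x M) :
    SpectralDecomp U (fun i => x i ^ 2) (M * M) := by
  refine ⟨h.mul_transpose, h.transpose_mul, ?_⟩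
  have : Matrix.diagonal (fun i => x i ^ 2) = Matrix.diagonal x * Matrix.diagonal x := by
    simp [sq]
  have h2 : M * M = U * Matrix.diagonal x * (Uᵀ * U) * Matrix.diagonal x * Uᵀ := by
    rw [h.eq]; simp only [Matrix.mul_assoc]
  rw [h2, this, h.transpose_mul]; simp only [Matrix.mul_assoc, Matrix.one_mul]

theorem trace (h : SpectralDecomp U x M) : M.trace = ∑ i, x i := by
  rw [h.eq, Matrix.trace_mul_comm, ← mul_assoc, h.transpose_mul, one_mul, Matrix.trace_diagonal]

theorem trace_mul_conj (h : SpectralDecomp U x M) (b : ι → ℝ) :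
    (M * (U * Matrix.diagonal b * Uᵀ)).trace = ∑ i, x i * b i := by
  have : M * (U * Matrix.diagonal b * Uᵀ) =
      U * (Matrix.diagonal x * (Uᵀ * U) * Matrix.diagonal b) * Uᵀ := by
    rw [h.eq]; simp only [Matrix.mul_assoc]
  rw [this, h.transpose_mul, mul_one, Matrix.trace_mul_comm, ← Matrix.mul_assoc,
    h.transpose_mul, one_mul, Matrix.diagonal_mul_diagonal, Matrix.trace_diagonal]

theorem sum_overlap_row (h : SpectralDecomp U x M) (k : SpectralDecomp V y N) (i : ι) :
    ∑ j, (Uᵀ * V) i j ^ 2 = 1 := by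
  have : (Uᵀ * V) * (Uᵀ * V)ᵀ = 1 := by
    rw [Matrix.transpose_mul, Matrix.transpose_transpose]
    calc Uᵀ * V * (Vᵀ * U) = Uᵀ * (V * Vᵀ) * U := by simp only [Matrix.mul_assoc]
      _ = 1 := by rw [k.mul_transpose, mul_one, h.transpose_mul]
  have := congrFun (congrFun this i) i
  rw [Matrix.mul_apply, Matrix.one_apply_eq] at this
  simpa only [Matrix.transpose_apply, sq] using this

theorem sum_overlap_col (h : SpectralDecomp U x M) (k : SpectralDecomp V y N) (j : ι) :
    ∑ i, (Uᵀ * V) i j ^ 2 = 1 := by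
  rw [← sum_overlap_row k h j]
  refine Finset.sum_congr rfl fun i _ => ?_
  have : Vᵀ * U = (Uᵀ * V)ᵀ := by simp [Matrix.transpose_mul]
  rw [this]; rfl

theorem conj_apply (k : SpectralDecomp V y N) (U : Matrix ι ι ℝ) (i : ι) :
    (Uᵀ * N * U) i i = ∑ j, (Uᵀ * V) i j ^ 2 * y j := by
  have : Uᵀ * N * U = (Uᵀ * V) * Matrix.diagonal y * (Uᵀ * V)ᵀ := by
    rw [k.eq, Matrix.transpose_mul, Matrix.transpose_transpose]; simp only [Matrix.mul_assoc]
  rw [this, Matrix.mul_apply]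
  refine Finset.sum_congr rfl fun j _ => ?_
  rw [Matrix.mul_diagonal, Matrix.transpose_apply]; ring

theorem sum_mul_conj_apply (U H : Matrix ι ι ℝ) (c : ι → ℝ) :
    ∑ i, c i * (Uᵀ * H * U) i i = (U * Matrix.diagonal c * Uᵀ * H).trace := by
  have : (U * Matrix.diagonal c * Uᵀ * H).trace = (Matrix.diagonal c * (Uᵀ * H * U)).trace := by
    rw [Matrix.mul_assoc, Matrix.mul_assoc, Matrix.trace_mul_comm]
    simp only [Matrix.mul_assoc]
  rw [this, Matrix.trace]
  simp [Matrix.diagonal_mul]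

theorem conj_self_apply (h : SpectralDecomp U x M) (i : ι) : (Uᵀ * M * U) i i = x i := by
  have : Uᵀ * M * U = (Uᵀ * U) * Matrix.diagonal x * (Uᵀ * U) := by
    rw [h.eq]; simp only [Matrix.mul_assoc]
  rw [this, h.transpose_mul]; simp

theorem conj_sub_apply (h : SpectralDecomp U x M) (k : SpectralDecomp V y N) (i : ι) :
    (Uᵀ * (N - M) * U) i i = ∑ j, (Uᵀ * V) i j ^ 2 * (y j - x i) := by
  rw [Matrix.mul_sub, Matrix.sub_mul, Matrix.sub_apply, k.conj_apply, h.conj_self_apply]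
  simp only [mul_sub, Finset.sum_sub_distrib, ← Finset.sum_mul]
  rw [h.sum_overlap_row k, one_mul]

/-- Since the overlaps have unit row and column sums, each single sum on the left can be spread over
all pairs `(i, j)`. With `f'` the derivative of `f`, this reduces a matrix Bregman divergence to
scalar ones. -/
theorem sum_sub_sum_sub (h : SpectralDecomp U x M) (k : SpectralDecomp V y N) (f f' : ℝ → ℝ) :
    ∑ j, f (y j) - ∑ i, f (x i) - ∑ i, f' (x i) * (Uᵀ * (N - M) * U) i i =
      ∑ i, ∑ j, (Uᵀ * V) i j ^ 2 * (f (y j) - f (x i) - f' (x i) * (y j - x i)) := by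
  have h1 : ∑ j, f (y j) = ∑ i, ∑ j, (Uᵀ * V) i j ^ 2 * f (y j) := by
    rw [Finset.sum_comm]
    simp only [← Finset.sum_mul, h.sum_overlap_col k, one_mul]
  have h2 : ∑ i, f (x i) = ∑ i, ∑ j, (Uᵀ * V) i j ^ 2 * f (x i) := by
    simp only [← Finset.sum_mul, h.sum_overlap_row k, one_mul]
  rw [h1, h2, ← Finset.sum_sub_distrib, ← Finset.sum_sub_distrib]
  refine Finset.sum_congr rfl fun i _ => ?_
  rw [h.conj_sub_apply k, Finset.mul_sum, ← Finset.sum_sub_distrib, ← Finset.sum_sub_distrib]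
  exact Finset.sum_congr rfl fun j _ => by ring

theorem trace_mul_sub (h : SpectralDecomp U x M) (k : SpectralDecomp V y N) (A : Matrix ι ι ℝ) :
    (A * (N - M)).trace = ∑ i, ∑ j, (y j - x i) * (Uᵀ * A * V) i j * (Uᵀ * V) i j := by
  have h1 : (A * N).trace = ∑ i, ∑ j, y j * (Uᵀ * A * V) i j * (Uᵀ * V) i j := by
    have : (A * N).trace = ((Uᵀ * A * V) * Matrix.diagonal y * (Uᵀ * V)ᵀ).trace := by
      rw [Matrix.transpose_mul, Matrix.transpose_transpose, Matrix.trace_mul_comm]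
      calc (N * A).trace = (V * Matrix.diagonal y * Vᵀ * (U * Uᵀ) * A).trace := by
            rw [h.mul_transpose, mul_one, ← k.eq]
        _ = ((V * Matrix.diagonal y * Vᵀ * U) * (Uᵀ * A)).trace := by
            simp only [Matrix.mul_assoc]
        _ = _ := by
            rw [Matrix.trace_mul_comm]
            simp only [Matrix.mul_assoc]
    rw [this, Matrix.trace]
    refine Finset.sum_congr rfl fun i _ => ?_
    rw [Matrix.diag_apply, Matrix.mul_apply]
    refine Finset.sum_congr rfl fun j _ => ?_
    rw [Matrix.mul_diagonal, Matrix.transpose_apply]; ring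
  have h2 : (A * M).trace = ∑ i, ∑ j, x i * (Uᵀ * A * V) i j * (Uᵀ * V) i j := by
    have : (A * M).trace = (Matrix.diagonal x * ((Uᵀ * A * V) * (Uᵀ * V)ᵀ)).trace := by
      rw [Matrix.transpose_mul, Matrix.transpose_transpose]
      calc (A * M).trace = (A * (V * Vᵀ) * U * Matrix.diagonal x * Uᵀ).trace := by
            rw [k.mul_transpose, mul_one, h.eq]; simp only [Matrix.mul_assoc]
        _ = _ := by
            rw [Matrix.trace_mul_comm, Matrix.trace_mul_comm (Matrix.diagonal x)]
            simp only [Matrix.mul_assoc]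
    rw [this, Matrix.trace]
    refine Finset.sum_congr rfl fun i _ => ?_
    rw [Matrix.diag_apply, Matrix.diagonal_mul, Matrix.mul_apply, Finset.mul_sum]
    refine Finset.sum_congr rfl fun j _ => ?_
    rw [Matrix.transpose_apply]; ring
  rw [Matrix.mul_sub, Matrix.trace_sub, h1, h2, ← Finset.sum_sub_distrib]
  refine Finset.sum_congr rfl fun i _ => ?_
  rw [← Finset.sum_sub_distrib]
  exact Finset.sum_congr rfl fun j _ => by ring

/-- In the mixed bases the entries of `N - M` are `(y j - x i)` times the overlaps, and the
Frobenius norm is orthogonally invariant. -/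
theorem sum_sq_sub (h : SpectralDecomp U x M) (k : SpectralDecomp V y N) :
    ∑ i, ∑ j, (N - M) i j ^ 2 = ∑ i, ∑ j, (Uᵀ * V) i j ^ 2 * (y j - x i) ^ 2 := by
  have h1 : ∑ i, ∑ j, (N - M) i j ^ 2 = ((N - M) * (N - M)).trace := by
    rw [Matrix.trace]
    refine Finset.sum_congr rfl fun i _ => ?_
    rw [Matrix.diag_apply, Matrix.mul_apply]
    refine Finset.sum_congr rfl fun j _ => ?_
    rw [sq, (k.isSymm.sub h.isSymm).apply i j]
  rw [h1, h.trace_mul_sub k]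
  refine Finset.sum_congr rfl fun i _ => Finset.sum_congr rfl fun j _ => ?_
  have : (Uᵀ * (N - M) * V) = (Uᵀ * V) * Matrix.diagonal y - Matrix.diagonal x * (Uᵀ * V) := by
    rw [Matrix.mul_sub, Matrix.sub_mul]
    congr 1
    · calc Uᵀ * N * V = Uᵀ * V * Matrix.diagonal y * (Vᵀ * V) := by
            rw [k.eq]; simp only [Matrix.mul_assoc]
        _ = _ := by rw [k.transpose_mul, mul_one]
    · calc Uᵀ * M * V = (Uᵀ * U) * Matrix.diagonal x * (Uᵀ * V) := by
            rw [h.eq]; simp only [Matrix.mul_assoc]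
        _ = _ := by rw [h.transpose_mul, one_mul]
  rw [this, Matrix.sub_apply, Matrix.mul_diagonal, Matrix.diagonal_mul]; ring

/-- The rows of `Uᵀ A V` have squared lengths given by the spectrum of the symmetric matrix `A`. -/
theorem sum_sq_row {E : Matrix ι ι ℝ} {a : ι → ℝ} {A : Matrix ι ι ℝ}
    (e : SpectralDecomp E a A) (k : SpectralDecomp V y N) (U : Matrix ι ι ℝ) (i : ι) :
    ∑ j, (Uᵀ * A * V) i j ^ 2 = ∑ l, (Uᵀ * E) i l ^ 2 * a l ^ 2 := by
  rw [← e.mul_self.conj_apply U i]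
  have : Uᵀ * (A * A) * U = (Uᵀ * A * V) * (Uᵀ * A * V)ᵀ := by
    rw [Matrix.transpose_mul, Matrix.transpose_mul, Matrix.transpose_transpose, e.isSymm.eq]
    calc Uᵀ * (A * A) * U = Uᵀ * A * (V * Vᵀ) * A * U := by
          rw [k.mul_transpose]; simp only [Matrix.mul_assoc, Matrix.one_mul]
      _ = _ := by simp only [Matrix.mul_assoc]
  rw [this, Matrix.mul_apply]
  exact Finset.sum_congr rfl fun j _ => by rw [Matrix.transpose_apply, sq]

theorem sum_sq_col {E : Matrix ι ι ℝ} {a : ι → ℝ} {A : Matrix ι ι ℝ}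
    (e : SpectralDecomp E a A) (h : SpectralDecomp U x M) (V : Matrix ι ι ℝ) (j : ι) :
    ∑ i, (Uᵀ * A * V) i j ^ 2 = ∑ l, (Vᵀ * E) j l ^ 2 * a l ^ 2 := by
  rw [← e.sum_sq_row h V j]
  refine Finset.sum_congr rfl fun i _ => ?_
  have : Vᵀ * A * U = (Uᵀ * A * V)ᵀ := by
    simp only [Matrix.transpose_mul, Matrix.transpose_transpose, e.isSymm.eq, Matrix.mul_assoc]
  rw [this]; rfl

end SpectralDecomp

end Spectral

/-! ### Greedy mirror descent and the counting of its states -/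

section Greedy

/-- The signed coordinate direction named by a symbol; `none` is the idle direction. -/
def signedDirection {n : ℕ} : Option (Fin n × Bool) → Fin n → ℝ
  | none => 0
  | some (i, true) => Pi.single i 1
  | some (i, false) => Pi.single i (-1)

/-- The dual vector reached from the origin by steps of length `η`, in any order. -/
def dualState {n : ℕ} (η : ℝ) (S : Multiset (Option (Fin n × Bool))) : Fin n → ℝ :=
  η • (S.map signedDirection).sum

/-- With `2n + 1` symbols, stars and bars gives `choose (12n) (10n)`. -/
theorem card_sym_symbols_le (n : ℕ) :
    Nat.card (Sym (Option (Fin n × Bool)) (10 * n)) ≤ 2 ^ (12 * n) := by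
  classical
  rw [Nat.card_eq_fintype_card, Sym.card_sym_eq_choose]
  refine (Nat.choose_le_two_pow _ _).trans (Nat.pow_le_pow_right (by norm_num) ?_)
  simp
  omega

theorem exists_signedDirection {n : ℕ} {ε : ℝ} {v : Fin n → ℝ} (h : ¬ ∀ i, |v i| ≤ ε) :
    ∃ (i : Fin n) (σ : Option (Fin n × Bool)) (s : ℝ),
      signedDirection σ = Pi.single i s ∧ s ^ 2 = 1 ∧ ε ≤ s * v i := by
  push Not at h
  obtain ⟨i, hi⟩ := h
  rcases lt_abs.1 hi with h | h
  · exact ⟨i, some (i, true), 1, rfl, by norm_num, by linarith⟩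
  · exact ⟨i, some (i, false), -1, rfl, by norm_num, by linarith⟩

/-- Greedy mirror descent: if every linear perturbation of `Ψ` by the functionals `a i` has a
minimizer on `X` with quadratic growth in every `a i`, then the sublevel set
`Ψ ≤ Ψ U₀ + D` is covered by few cubes of half-width `√(D / n)`. -/
theorem exists_small_net {E : Type*} {n : ℕ} (hn : 0 < n) (a : Fin n → E → ℝ) (Ψ : E → ℝ)
    (X : Set E) (D : ℝ)
    (hmin : ∀ k : Fin n → ℝ, ∃ V ∈ X, ∀ W ∈ X, ∀ i, 1 / 10 * (a i W - a i V) ^ 2 ≤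
      (Ψ W - ∑ j, k j * a j W) - (Ψ V - ∑ j, k j * a j V))
    (U₀ : E) (hU₀ : ∀ W ∈ X, Ψ U₀ ≤ Ψ W) :
    ∃ Z : Set (Fin n → ℝ), Z.encard ≤ 2 ^ (12 * n) ∧
      ∀ U ∈ X, Ψ U - Ψ U₀ ≤ D → ∃ z ∈ Z, ∀ i, |a i U - z i| ≤ √(D / n) := by
  classical
  choose V hVX hV using hmin
  set ε := √(D / n) with hε
  have hε0 : 0 ≤ ε := Real.sqrt_nonneg _
  -- This step length maximizes the guaranteed decrease `η ε - (5/2) η²`, with value `ε² / 10`.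
  set η := ε / 5 with hη
  let T := 10 * n
  refine ⟨Set.range fun S : Sym (Option (Fin n × Bool)) T => fun i =>
      a i (V (dualState η (S : Multiset _))), ?_, ?_⟩
  · rw [← Set.image_univ]
    refine (Set.encard_image_le _ _).trans ?_
    rw [Set.encard_univ, ENat.card_eq_coe_natCard]
    exact_mod_cast card_sym_symbols_le n
  intro U hU hUD
  let F : (Fin n → ℝ) → ℝ := fun k =>
    (Ψ U - ∑ j, k j * a j U) - (Ψ (V k) - ∑ j, k j * a j (V k))
  -- After `t` symbols the run has either succeeded or paid `ε² / 10` for each of them.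
  have key : ∀ t : ℕ, ∃ S : Multiset (Option (Fin n × Bool)), S.card = t ∧
      ((∀ i, |a i U - a i (V (dualState η S))| ≤ ε) ∨
        F (dualState η S) ≤ D - t * (ε ^ 2 / 10)) := by
    intro t
    induction t with
    | zero =>
      refine ⟨0, rfl, Or.inr ?_⟩
      have := hU₀ _ (hVX 0)
      simp only [dualState, Multiset.map_zero, Multiset.sum_zero, smul_zero, F, Pi.zero_apply,
        zero_mul, Finset.sum_const_zero, sub_zero, Nat.cast_zero]
      linarith
    | succ t ih =>
      obtain ⟨S, hS, h⟩ := ih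
      by_cases hg : ∀ i, |a i U - a i (V (dualState η S))| ≤ ε
      -- Once successful, the run idles, so that every code has the same length.
      · refine ⟨none ::ₘ S, by simp [hS], Or.inl ?_⟩
        have : dualState η (none ::ₘ S) = dualState η S := by
          simp [dualState, signedDirection]
        rwa [this]
      · have hF := h.resolve_left hg
        obtain ⟨i, σ, s, hσ, hs, hi⟩ := exists_signedDirection hg
        refine ⟨σ ::ₘ S, by simp [hS], Or.inr ?_⟩
        set k := dualState η S with hk
        have hk' : dualState η (σ ::ₘ S) = k + Pi.single i (η * s) := by
          rw [hk, dualState, Multiset.map_cons, Multiset.sum_cons, hσ, smul_add, add_comm,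
            dualState, ← Pi.single_smul, smul_eq_mul]
        rw [hk']
        set k' := k + Pi.single i (η * s) with hkk
        have hsum : ∀ W, ∑ j, k' j * a j W = ∑ j, k j * a j W + η * s * a i W := by
          intro W
          simp [hkk, add_mul, Finset.sum_add_distrib, Pi.single_apply]
        have h1 := hV k (V k') (hVX k') i
        have h2 : F k' ≤ F k - η * (s * (a i U - a i (V k)))
            + η * s * (a i (V k') - a i (V k)) - 1 / 10 * (a i (V k') - a i (V k)) ^ 2 := by
          simp only [F, hsum]
          linarith
        -- Completing the square: the quadratic growth at `V k` pays for the displacement of the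
        -- minimizer, whatever its size.
        have h3 : η * s * (a i (V k') - a i (V k)) - 1 / 10 * (a i (V k') - a i (V k)) ^ 2
            ≤ 5 / 2 * η ^ 2 := by
          nlinarith [sq_nonneg (1 / 10 * (a i (V k') - a i (V k)) - 1 / 2 * η * s),
            mul_pow η s 2]
        have h4 : η * ε ≤ η * (s * (a i U - a i (V k))) :=
          mul_le_mul_of_nonneg_left hi (by positivity)
        have h5 : η = ε / 5 := hη
        push_cast
        rw [h5] at h3 h4 h2
        nlinarith
  obtain ⟨S, hS, h⟩ := key T
  refine ⟨_, ⟨⟨S, hS⟩, rfl⟩, fun i => ?_⟩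
  rcases h with h | h
  · exact h i
  have hn' : (0 : ℝ) < n := Nat.cast_pos.2 hn
  -- For negative `D` the square root is `0` by convention and the bound still holds.
  have hD : D ≤ n * ε ^ 2 := by
    rcases le_total 0 D with hD | hD
    · rw [hε, Real.sq_sqrt (by positivity)]
      field_simp
      exact le_rfl
    · exact hD.trans (by positivity)
  have h1 := hV (dualState η S) U hU i
  -- The budget is spent after `10 n` steps. Quadratic growth then forces the measurements of `U`
  -- and of the last iterate to agree exactly.
  have h2 : F (dualState η S) ≤ 0 := by
    refine h.trans ?_
    simp only [T]; push_cast; nlinarith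
  have h3 : (a i U - a i (V (dualState η S))) ^ 2 ≤ 0 := by
    simp only [F] at h2; linarith
  have h4 : a i U - a i (V (dualState η S)) = 0 := by nlinarith
  simpa [h4] using hε0

theorem mem_vadd_smul_unitCube {n : ℕ} {ε : ℝ} (hε : 0 ≤ ε) {x z : Fin n → ℝ}
    (h : ∀ i, |x i - z i| ≤ ε) : x ∈ z +ᵥ ε • unitCube n := by
  rw [Set.mem_vadd_set]
  refine ⟨x - z, ?_, by simp⟩
  rw [Set.mem_smul_set]
  -- At radius zero the scaled cube is the single point `0` and no rescaling is possible.
  rcases hε.eq_or_lt with rfl | hε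
  · refine ⟨0, by simp [unitCube], ?_⟩
    ext i
    have := abs_nonpos_iff.1 (h i)
    simp [this]
  · refine ⟨ε⁻¹ • (x - z), fun i => ?_, by simp [hε.ne']⟩
    simp only [Pi.smul_apply, Pi.sub_apply, smul_eq_mul, abs_mul, abs_inv, abs_of_pos hε]
    rw [inv_mul_le_iff₀ hε]
    simpa using h i

/-- Nets for the sublevel sets around every point of `T₀` combine into a cover. -/
theorem coveringNumber_image_le {E : Type*} {n C₀ : ℕ} (a : E → Fin n → ℝ) (T₀ T' : Set E)
    (D : ℝ) (d : E → E → ℝ) (hT₀ : T₀.encard ≤ 2 ^ (C₀ * n))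
    (hT' : ∀ U ∈ T', ∃ U₀ ∈ T₀, d U U₀ ≤ D)
    (hnet : ∀ U₀ ∈ T₀, ∃ Z : Set (Fin n → ℝ), Z.encard ≤ 2 ^ (12 * n) ∧
      ∀ U ∈ T', d U U₀ ≤ D → ∃ z ∈ Z, ∀ i, |a U i - z i| ≤ √(D / n)) :
    coveringNumber (a '' T') (√(D / n) • unitCube n) ≤ 2 ^ ((C₀ + 12) * n) := by
  classical
  have hfin : T₀.Finite := by
    rw [← Set.encard_lt_top_iff]
    refine hT₀.trans_lt ?_
    exact_mod_cast ENat.natCast_lt_top (2 ^ (C₀ * n))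
  choose! Z hZ hZU using hnet
  have hcard : (⋃ U₀ ∈ T₀, Z U₀).encard ≤ 2 ^ ((C₀ + 12) * n) := by
    have h1 : ∀ s : Finset E, (s : Set E) ⊆ T₀ →
        (⋃ U₀ ∈ s, Z U₀).encard ≤ s.card * 2 ^ (12 * n) := by
      intro s
      induction s using Finset.induction_on with
      | empty => simp
      | insert x s hx ih =>
        intro hs
        rw [Finset.set_biUnion_insert, Finset.card_insert_of_notMem hx]
        refine (Set.encard_union_le _ _).trans ?_
        rw [Finset.coe_insert, Set.insert_subset_iff] at hs
        push_cast
        rw [add_mul, one_mul, add_comm]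
        exact add_le_add (ih hs.2) (hZ x hs.1)
    have h2 := h1 hfin.toFinset (by simp)
    have h3 : (hfin.toFinset.card : ℕ∞) = T₀.encard := by
      rw [hfin.encard_eq_coe_toFinset_card]
    simp only [Set.Finite.mem_toFinset] at h2
    refine h2.trans ?_
    rw [h3, add_mul, pow_add]
    gcongr
  refine (iInf₂_le (⋃ U₀ ∈ T₀, Z U₀) ?_).trans hcard
  rintro _ ⟨U, hU, rfl⟩
  obtain ⟨U₀, hU₀, hd⟩ := hT' U hU
  obtain ⟨z, hz, hzi⟩ := hZU U₀ hU₀ U hU hd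
  refine Set.mem_iUnion₂.2 ⟨z, Set.mem_iUnion₂.2 ⟨U₀, hU₀, hz⟩, ?_⟩
  exact mem_vadd_smul_unitCube (Real.sqrt_nonneg _) hzi

end Greedy

/-! ### Scalar remainder estimates -/

section Scalar

/-- Near `x` the derivative supplies the `ε` term; at distance at least `δ`, every term is absorbed
by a multiple of `(y - x) ^ 2` because `f` grows at most quadratically. A bound valid for all `y` is
needed since an eigenvalue of a nearby matrix is compared with every eigenvalue of the given one. -/
theorem exists_remainder_bound {f : ℝ → ℝ} {f' x C : ℝ} (hgrow : ∀ t, |f t| ≤ C * (1 + t ^ 2))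
    (hf : HasDerivAt f f' x) {ε : ℝ} (hε : 0 < ε) :
    ∃ K, 0 ≤ K ∧ ∀ y, |f y - f x - f' * (y - x)| ≤ ε * |y - x| + K * (y - x) ^ 2 := by
  have hC : 0 ≤ C := by
    have := (abs_nonneg _).trans (hgrow 0); simpa using this
  have h1 := (hasDerivAt_iff_isLittleO.1 hf).def hε
  obtain ⟨δ, hδ, h2⟩ := Metric.eventually_nhds_iff.1 h1
  set P := C * (1 + 2 * x ^ 2) + |f x| with hP
  have hP0 : 0 ≤ P := by positivity
  refine ⟨P / δ ^ 2 + 2 * C + |f'| / δ, by positivity, fun y => ?_⟩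
  by_cases hy : |y - x| < δ
  · have := h2 (y := y) (by rwa [Real.dist_eq])
    simp only [smul_eq_mul, Real.norm_eq_abs] at this
    have h3 : 0 ≤ (P / δ ^ 2 + 2 * C + |f'| / δ) * (y - x) ^ 2 := by positivity
    rw [mul_comm f']
    linarith
  · have hy := not_lt.1 hy
    have hd : δ ^ 2 ≤ (y - x) ^ 2 := by
      rw [← sq_abs (y - x)]; exact pow_le_pow_left₀ hδ.le hy 2
    have a1 : P ≤ P / δ ^ 2 * (y - x) ^ 2 := by
      rw [div_mul_eq_mul_div, le_div_iff₀ (by positivity)]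
      exact mul_le_mul_of_nonneg_left hd hP0
    have a2 : |f' * (y - x)| ≤ |f'| / δ * (y - x) ^ 2 := by
      rw [abs_mul, div_mul_eq_mul_div, le_div_iff₀ hδ, mul_assoc, ← sq_abs (y - x), sq]
      exact mul_le_mul_of_nonneg_left
        (mul_le_mul_of_nonneg_left hy (abs_nonneg _)) (abs_nonneg _)
    have a3 : |f y| ≤ C * (1 + 2 * x ^ 2) + 2 * C * (y - x) ^ 2 := by
      refine (hgrow y).trans ?_
      have : y ^ 2 ≤ 2 * x ^ 2 + 2 * (y - x) ^ 2 := by nlinarith [sq_nonneg (y - 2 * x)]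
      nlinarith
    have a4 : |f y - f x - f' * (y - x)| ≤ |f y| + |f x| + |f' * (y - x)| :=
      (abs_sub _ _).trans (add_le_add_left (abs_sub _ _) _)
    have a5 : 0 ≤ ε * |y - x| := by positivity
    linarith

/-- The inequality `log t ≤ t - 1` at `t = √x / √y` bounds the remainder below by `(√y - √x)²`, and
`(√x + √y)² ≤ 2 (x + y)` converts this to the stated form. -/
theorem entropy_remainder_ge {x y : ℝ} (hx : 0 < x) (hy : 0 < y) :
    1 / 2 * ((y - x) ^ 2 * (x + y)⁻¹) ≤
      y * Real.log y - x * Real.log x - (Real.log x + 1) * (y - x) := by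
  set a := √x with ha
  set b := √y with hb
  have ha0 : 0 < a := Real.sqrt_pos.2 hx
  have hb0 : 0 < b := Real.sqrt_pos.2 hy
  have hxa : x = a ^ 2 := (Real.sq_sqrt hx.le).symm
  have hyb : y = b ^ 2 := (Real.sq_sqrt hy.le).symm
  have h1 : Real.log (a / b) ≤ a / b - 1 := Real.log_le_sub_one_of_pos (by positivity)
  rw [Real.log_div ha0.ne' hb0.ne'] at h1
  have h2 : (b - a) ^ 2 ≤ y * Real.log y - x * Real.log x - (Real.log x + 1) * (y - x) := by
    rw [hxa, hyb, Real.log_pow, Real.log_pow]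
    push_cast
    have h3 : b ^ 2 * (Real.log a - Real.log b) ≤ b ^ 2 * (a / b - 1) :=
      mul_le_mul_of_nonneg_left h1 (by positivity)
    have h4 : b ^ 2 * (a / b - 1) = a * b - b ^ 2 := by field_simp
    nlinarith
  refine le_trans ?_ h2
  rw [← div_eq_mul_inv, ← mul_div_assoc, div_le_iff₀ (by positivity), hxa, hyb]
  have : (b ^ 2 - a ^ 2) ^ 2 = (b - a) ^ 2 * (a + b) ^ 2 := by ring
  rw [this]
  have : (a + b) ^ 2 ≤ 2 * (a ^ 2 + b ^ 2) := by nlinarith [sq_nonneg (a - b)]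
  nlinarith [sq_nonneg (b - a)]

theorem abs_mul_log_le (t : ℝ) : |t * Real.log t| ≤ 1 * (1 + t ^ 2) := by
  rw [one_mul, abs_mul]
  rcases eq_or_ne t 0 with rfl | ht
  · simp
  have h0 : 0 < |t| := abs_pos.2 ht
  have h1 := Real.log_le_sub_one_of_pos h0
  have h2 := Real.log_le_sub_one_of_pos (inv_pos.2 h0)
  rw [Real.log_inv] at h2
  rw [← Real.log_abs t, ← sq_abs t]
  rcases abs_cases (Real.log |t|) with ⟨h, -⟩ | ⟨h, -⟩ <;> rw [h]
  · nlinarith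
  · have : |t| * -Real.log |t| ≤ |t| * (|t|⁻¹ - 1) := mul_le_mul_of_nonneg_left h2 h0.le
    rw [mul_sub, mul_inv_cancel₀ h0.ne'] at this
    nlinarith [sq_nonneg |t|]

theorem abs_rpow_le_one_add_sq {p : ℝ} (hp : 0 ≤ p) (hp2 : p ≤ 2) (t : ℝ) :
    |(|t| ^ p)| ≤ 1 * (1 + t ^ 2) := by
  rw [one_mul, abs_of_nonneg (by positivity)]
  rcases le_total |t| 1 with h | h
  · have := Real.rpow_le_one (abs_nonneg t) h hp
    nlinarith [sq_nonneg t]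
  · have := Real.rpow_le_rpow_of_exponent_le h hp2
    rw [Real.rpow_two, sq_abs] at this
    linarith

/-- The derivative of `|t| ^ p` grows at least linearly on `[-R, R]`. -/
theorem abs_rpow_deriv_sub_ge {p R s t : ℝ} (hp : 1 < p) (hp2 : p ≤ 2) (hs : |s| ≤ R)
    (ht : |t| ≤ R) (hst : s ≤ t) :
    (p - 1) * R ^ (p - 2) * (t - s) ≤ |t| ^ (p - 2) * t - |s| ^ (p - 2) * s := by
  have pos : ∀ s t : ℝ, 0 ≤ s → s ≤ t → t ≤ R →
      (p - 1) * R ^ (p - 2) * (t - s) ≤ |t| ^ (p - 2) * t - |s| ^ (p - 2) * s := by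
    intro s t hs hst ht
    rcases hst.eq_or_lt with rfl | hst
    · simp
    have ht0 : 0 < t := hs.trans_lt hst
    rw [abs_of_pos ht0, abs_of_nonneg hs]
    have h1 : R ^ (p - 2) ≤ t ^ (p - 2) :=
      Real.rpow_le_rpow_of_nonpos ht0 ht (by linarith)
    have h2 : s ^ (p - 2) * s ≤ t ^ (p - 2) * t + (p - 1) * t ^ (p - 2) * (s - t) := by
      have e : ∀ u : ℝ, 0 ≤ u → u ^ (p - 2) * u = u ^ (p - 1) := by
        intro u hu
        rcases hu.eq_or_lt with rfl | hu
        · rw [mul_zero, Real.zero_rpow (by linarith)]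
        · rw [← Real.rpow_add_one hu.ne']; ring_nf
      -- Bernoulli for the exponent `p - 1 ≤ 1`: the concave function `u ^ (p - 1)` lies below its
      -- tangent at `t`.
      have b := rpow_one_add_le_one_add_mul_self (s := s / t - 1) (p := p - 1)
        (by have : 0 ≤ s / t := by positivity
            linarith) (by linarith) (by linarith)
      rw [add_sub_cancel, Real.div_rpow hs ht0.le, div_le_iff₀ (by positivity)] at b
      rw [e s hs]
      refine b.trans (le_of_eq ?_)
      rw [← e t ht0.le]
      field_simp
    have h3 : (p - 1) * R ^ (p - 2) * (t - s) ≤ (p - 1) * t ^ (p - 2) * (t - s) := by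
      refine mul_le_mul_of_nonneg_right ?_ (by linarith)
      exact mul_le_mul_of_nonneg_left h1 (by linarith)
    linarith
  rw [abs_le] at hs ht
  -- The derivative is odd, so the remaining cases follow by reflection or by splitting the interval
  -- at `0`.
  rcases le_total 0 s with h | h
  · exact pos s t h hst ht.2
  rcases le_total 0 t with h' | h'
  · have h1 := pos 0 t le_rfl h' ht.2
    have h2 := pos 0 (-s) le_rfl (by linarith) (by linarith)
    rw [abs_neg] at h2
    simp only [mul_zero, sub_zero] at h1 h2
    linarith
  · have h1 := pos (-t) (-s) (by linarith) (by linarith) (by linarith)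
    rw [abs_neg, abs_neg] at h1
    linarith

/-- On `[-R, R]` with `R = |x| + |y|` the derivative of `|t| ^ p` has slope at least `p (p - 1) R ^
(p - 2)`. Working with increments of the first derivative avoids the singular second derivative at
`0`. -/
theorem abs_rpow_remainder_ge {p : ℝ} (hp : 1 < p) (hp2 : p ≤ 2) (x y : ℝ) :
    p * (p - 1) / 2 * ((y - x) ^ 2 * (|x| + |y|) ^ (p - 2)) ≤
      |y| ^ p - |x| ^ p - p * |x| ^ (p - 2) * x * (y - x) := by
  set R := |x| + |y| with hR
  set κ := p * (p - 1) * R ^ (p - 2) with hκ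
  have hxR : |x| ≤ R := by linarith [abs_nonneg y]
  have hyR : |y| ≤ R := by linarith [abs_nonneg x]
  let φ : ℝ → ℝ := fun t => |t| ^ p - p * |x| ^ (p - 2) * x * (t - x) - κ / 2 * (t - x) ^ 2
  let φ' : ℝ → ℝ := fun t => p * |t| ^ (p - 2) * t - p * |x| ^ (p - 2) * x - κ * (t - x)
  have hφ : ∀ t, HasDerivAt φ (φ' t) t := by
    intro t
    have h1 := hasDerivAt_abs_rpow t hp
    have h2 : HasDerivAt (fun t => p * |x| ^ (p - 2) * x * (t - x)) (p * |x| ^ (p - 2) * x) t := by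
      simpa using ((hasDerivAt_id t).sub_const x).const_mul (p * |x| ^ (p - 2) * x)
    have h3 : HasDerivAt (fun t => κ / 2 * (t - x) ^ 2) (κ * (t - x)) t := by
      have := (((hasDerivAt_id t).sub_const x).pow 2).const_mul (κ / 2)
      convert! this using 1
      simp; ring
    exact (h1.sub h2).sub h3
  have hcont : Continuous φ := continuous_iff_continuousAt.2 fun t => (hφ t).continuousAt
  have main : φ x ≤ φ y := by
    rcases lt_trichotomy x y with h | rfl | h
    · obtain ⟨c, hc, he⟩ := exists_hasDerivAt_eq_slope φ φ' h hcont.continuousOn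
        fun t _ => hφ t
      have hcR : |c| ≤ R := by
        rw [abs_le] at *; exact ⟨by linarith [hc.1], by linarith [hc.2]⟩
      have h1 := abs_rpow_deriv_sub_ge hp hp2 hxR hcR hc.1.le
      have h2 : 0 ≤ φ' c := by simp only [φ', hκ]; nlinarith
      rw [he, le_div_iff₀ (by linarith)] at h2
      linarith
    · exact le_rfl
    · obtain ⟨c, hc, he⟩ := exists_hasDerivAt_eq_slope φ φ' h hcont.continuousOn
        fun t _ => hφ t
      have hcR : |c| ≤ R := by
        rw [abs_le] at *; exact ⟨by linarith [hc.1], by linarith [hc.2]⟩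
      have h1 := abs_rpow_deriv_sub_ge hp hp2 hcR hxR hc.2.le
      have h2 : φ' c ≤ 0 := by simp only [φ', hκ]; nlinarith
      rw [he, div_le_iff₀ (by linarith)] at h2
      linarith
  simp only [φ, sub_self, hκ] at main
  nlinarith

end Scalar

/-! ### Differentiability and weighted Cauchy–Schwarz for trace functions -/

section TraceFunction

variable {ι : Type*} [Fintype ι] [DecidableEq ι]

namespace SpectralDecomp

variable {U V E : Matrix ι ι ℝ} {x y a : ι → ℝ} {M N A : Matrix ι ι ℝ}

/-- The scalar bounds are averaged over the overlaps. The constant `K` is uniform in the eigenbasis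
of `N`, so no continuity of eigenvectors is required. -/
theorem exists_trace_remainder_bound (h : SpectralDecomp U x M) {f f' : ℝ → ℝ} {C : ℝ}
    (hgrow : ∀ t, |f t| ≤ C * (1 + t ^ 2)) (hf : ∀ i, HasDerivAt f (f' (x i)) (x i))
    {ε : ℝ} (hε : 0 < ε) :
    ∃ K, 0 ≤ K ∧ ∀ (V : Matrix ι ι ℝ) (y : ι → ℝ) (N : Matrix ι ι ℝ), SpectralDecomp V y N →
      ∀ r, 0 ≤ r → ∑ i, ∑ j, (N - M) i j ^ 2 ≤ r ^ 2 →
        |∑ j, f (y j) - ∑ i, f (x i) - ∑ i, f' (x i) * (Uᵀ * (N - M) * U) i i| ≤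
          ε * r + K * r ^ 2 := by
  obtain ⟨c, hc⟩ : ∃ c : ℝ, c = (Fintype.card ι : ℝ) := ⟨_, rfl⟩
  have hc0 : 0 ≤ c := hc ▸ Nat.cast_nonneg _
  have hε' : 0 < ε / (c + 1) := by positivity
  choose K hK0 hK using fun i => exists_remainder_bound hgrow (hf i) hε'
  refine ⟨∑ i, K i, Finset.sum_nonneg fun i _ => hK0 i, fun V y N k r hr hq => ?_⟩
  rw [h.sum_sq_sub k] at hq
  rw [h.sum_sub_sum_sub k]
  set w : ι → ι → ℝ := fun i j => (Uᵀ * V) i j ^ 2 with hw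
  have hw0 : ∀ i j, 0 ≤ w i j := fun i j => sq_nonneg _
  have h1 : |∑ i, ∑ j, w i j * (f (y j) - f (x i) - f' (x i) * (y j - x i))| ≤
      ∑ i, ∑ j, (ε / (c + 1) * (w i j * |y j - x i|) +
        (∑ i, K i) * (w i j * (y j - x i) ^ 2)) := by
    refine (Finset.abs_sum_le_sum_abs _ _).trans (Finset.sum_le_sum fun i _ => ?_)
    refine (Finset.abs_sum_le_sum_abs _ _).trans (Finset.sum_le_sum fun j _ => ?_)
    rw [abs_mul, abs_of_nonneg (hw0 i j)]
    have hKi : K i ≤ ∑ i, K i := Finset.single_le_sum (fun i _ => hK0 i) (Finset.mem_univ i)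
    have h2 : |f (y j) - f (x i) - f' (x i) * (y j - x i)| ≤
        ε / (c + 1) * |y j - x i| + (∑ i, K i) * (y j - x i) ^ 2 :=
      (hK i (y j)).trans (by gcongr)
    calc _ ≤ w i j * (ε / (c + 1) * |y j - x i| + (∑ i, K i) * (y j - x i) ^ 2) :=
          mul_le_mul_of_nonneg_left h2 (hw0 i j)
      _ = _ := by ring
  refine h1.trans ?_
  simp only [Finset.sum_add_distrib, ← Finset.mul_sum]
  -- Cauchy–Schwarz with total weight `c` gives `√c * r`; using `c + 1` also keeps the denominator
  -- positive for an empty index type.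
  have h3 : ∑ i, ∑ j, w i j * |y j - x i| ≤ (c + 1) * r := by
    refine abs_le_of_sq_le_sq' ?_ (by positivity) |>.2
    have h4 := Finset.sum_sq_le_sum_mul_sum_of_sq_le_mul (Finset.univ : Finset (ι × ι))
      (r := fun z => w z.1 z.2 * |y z.2 - x z.1|) (f := fun z => w z.1 z.2)
      (g := fun z => w z.1 z.2 * (y z.2 - x z.1) ^ 2) (fun z _ => hw0 _ _)
      (fun z _ => mul_nonneg (hw0 _ _) (sq_nonneg _))
      (fun z _ => by rw [mul_pow, sq_abs]; exact (by ring : _ = _).le)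
    simp only [Fintype.sum_prod_type] at h4
    have h5 : ∑ i, ∑ j, w i j = c := by
      simp only [hw, h.sum_overlap_row k]; simp [hc]
    rw [h5] at h4
    refine h4.trans ?_
    rw [mul_pow]
    refine mul_le_mul ?_ hq ?_ (by positivity)
    · nlinarith
    · exact Finset.sum_nonneg fun i _ => Finset.sum_nonneg fun j _ =>
        mul_nonneg (hw0 _ _) (sq_nonneg _)
  refine add_le_add ?_ (mul_le_mul_of_nonneg_left hq (Finset.sum_nonneg fun i _ => hK0 i))
  calc ε / (c + 1) * ∑ i, ∑ j, w i j * |y j - x i| ≤ ε / (c + 1) * ((c + 1) * r) := by gcongr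
    _ = ε * r := by field_simp

/-- Weighted Cauchy–Schwarz for `tr (A (N - M))` in the eigenbases of `M` and `N`. -/
theorem trace_mul_sub_sq_le (h : SpectralDecomp U x M) (k : SpectralDecomp V y N)
    (e : SpectralDecomp E a A) {κ l : ι → ι → ℝ} {α β : ι → ℝ} (hκ : ∀ i j, 0 ≤ κ i j)
    (hl : ∀ i j, 0 ≤ l i j) (hkl : ∀ i j, y j ≠ x i → κ i j * l i j = 1)
    (hαβ : ∀ i j, κ i j ≤ α i + β j) :
    (A * (N - M)).trace ^ 2 ≤
      (∑ i, ∑ j, (Uᵀ * V) i j ^ 2 * ((y j - x i) ^ 2 * l i j)) *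
        (∑ i, ∑ m, (Uᵀ * E) i m ^ 2 * (α i * a m ^ 2) +
          ∑ j, ∑ m, (Vᵀ * E) j m ^ 2 * (β j * a m ^ 2)) := by
  rw [h.trace_mul_sub k]
  have h4 := Finset.sum_sq_le_sum_mul_sum_of_sq_le_mul (Finset.univ : Finset (ι × ι))
    (r := fun z => (y z.2 - x z.1) * (Uᵀ * A * V) z.1 z.2 * (Uᵀ * V) z.1 z.2)
    (f := fun z => (Uᵀ * V) z.1 z.2 ^ 2 * ((y z.2 - x z.1) ^ 2 * l z.1 z.2))
    (g := fun z => κ z.1 z.2 * (Uᵀ * A * V) z.1 z.2 ^ 2)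
    (fun z _ => mul_nonneg (sq_nonneg _) (mul_nonneg (sq_nonneg _) (hl _ _)))
    (fun z _ => mul_nonneg (hκ _ _) (sq_nonneg _))
    (fun z _ => by
      refine le_of_eq ?_
      -- Where the eigenvalues agree the term vanishes, so the weights need not be reciprocal there;
      -- this covers `x i = y j = 0`.
      by_cases hz : y z.2 = x z.1
      · simp [hz]
      · calc _ = ((y z.2 - x z.1) * (Uᵀ * A * V) z.1 z.2 * (Uᵀ * V) z.1 z.2) ^ 2 *
              (κ z.1 z.2 * l z.1 z.2) := by rw [hkl _ _ hz, mul_one]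
          _ = _ := by ring)
  simp only [Fintype.sum_prod_type] at h4
  refine h4.trans (mul_le_mul_of_nonneg_left ?_ ?_)
  · calc ∑ i, ∑ j, κ i j * (Uᵀ * A * V) i j ^ 2
        ≤ ∑ i, ∑ j, (α i * (Uᵀ * A * V) i j ^ 2 + β j * (Uᵀ * A * V) i j ^ 2) := by
          refine Finset.sum_le_sum fun i _ => Finset.sum_le_sum fun j _ => ?_
          rw [← add_mul]
          exact mul_le_mul_of_nonneg_right (hαβ i j) (sq_nonneg _)
      _ = _ := by
          simp only [Finset.sum_add_distrib]
          congr 1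
          · refine Finset.sum_congr rfl fun i _ => ?_
            rw [← Finset.mul_sum, e.sum_sq_row k, Finset.mul_sum]
            exact Finset.sum_congr rfl fun m _ => by ring
          · rw [Finset.sum_comm]
            refine Finset.sum_congr rfl fun j _ => ?_
            rw [← Finset.mul_sum, e.sum_sq_col h, Finset.mul_sum]
            exact Finset.sum_congr rfl fun m _ => by ring
  · exact Finset.sum_nonneg fun i _ => Finset.sum_nonneg fun j _ =>
      mul_nonneg (sq_nonneg _) (mul_nonneg (sq_nonneg _) (hl _ _))

end SpectralDecomp

/-- A trace function composed with a linear map into the symmetric matrices is differentiable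
wherever the scalar function is differentiable on the spectrum. -/
theorem hasFDerivAt_spectralSum {F : Type*} [NormedAddCommGroup F] [NormedSpace ℝ F]
    [FiniteDimensional ℝ F] (ℓ : F →ₗ[ℝ] Matrix ι ι ℝ) (hℓ : ∀ H, (ℓ H).IsSymm)
    {f f' : ℝ → ℝ} {C : ℝ} (hgrow : ∀ t, |f t| ≤ C * (1 + t ^ 2)) (G : F → ℝ)
    (hG : ∀ (X : F) (U : Matrix ι ι ℝ) (x : ι → ℝ), SpectralDecomp U x (ℓ X) →
      G X = ∑ i, f (x i))
    {X : F} {U : Matrix ι ι ℝ} {x : ι → ℝ} (h : SpectralDecomp U x (ℓ X))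
    (hf : ∀ i, HasDerivAt f (f' (x i)) (x i)) (L : F →L[ℝ] ℝ)
    (hL : ∀ H, L H = ∑ i, f' (x i) * (Uᵀ * ℓ H * U) i i) :
    HasFDerivAt G L X := by
  obtain ⟨c, hc0, hc⟩ : ∃ c : ℝ, 0 ≤ c ∧ ∀ H, ∑ i, ∑ j, ℓ H i j ^ 2 ≤ (c * ‖H‖) ^ 2 := by
    let e : ι → ι → F →ₗ[ℝ] ℝ := fun i j =>
      { toFun := fun H => ℓ H i j
        map_add' := fun a b => by simp
        map_smul' := fun a b => by simp }
    let e' : ι → ι → F →L[ℝ] ℝ := fun i j => LinearMap.toContinuousLinearMap (e i j)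
    refine ⟨√(∑ i, ∑ j, ‖e' i j‖ ^ 2), Real.sqrt_nonneg _, fun H => ?_⟩
    rw [mul_pow, Real.sq_sqrt (by positivity), Finset.sum_mul]
    refine Finset.sum_le_sum fun i _ => ?_
    rw [Finset.sum_mul]
    refine Finset.sum_le_sum fun j _ => ?_
    have := (e' i j).le_opNorm H
    rw [← mul_pow, ← sq_abs]
    exact pow_le_pow_left₀ (abs_nonneg _) this 2
  rw [hasFDerivAt_iff_isLittleO, Asymptotics.isLittleO_iff]
  intro ε hε
  obtain ⟨K, hK0, hK⟩ := h.exists_trace_remainder_bound hgrow hf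
    (ε := ε / (2 * (c + 1))) (by positivity)
  have hδ : 0 < ε / (2 * (K * c ^ 2 + 1)) := by positivity
  filter_upwards [Metric.ball_mem_nhds X hδ] with Y hY
  rw [Metric.mem_ball, dist_eq_norm] at hY
  obtain ⟨V, y, k⟩ := exists_spectralDecomp (hℓ Y)
  have h1 := hK V y _ k (c * ‖Y - X‖) (by positivity) (by rw [← map_sub]; exact hc _)
  rw [hG X U x h, hG Y V y k, hL, map_sub, Real.norm_eq_abs]
  refine h1.trans ?_
  have n0 := norm_nonneg (Y - X)
  have h2 : ε / (2 * (c + 1)) * (c * ‖Y - X‖) ≤ ε / 2 * ‖Y - X‖ := by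
    rw [← mul_assoc]
    refine mul_le_mul_of_nonneg_right ?_ n0
    rw [div_mul_eq_mul_div, div_le_div_iff₀ (by positivity) (by positivity)]
    nlinarith
  have h3 : K * (c * ‖Y - X‖) ^ 2 ≤ ε / 2 * ‖Y - X‖ := by
    have : K * c ^ 2 * ‖Y - X‖ ≤ ε / 2 := by
      have h5 : (K * c ^ 2 + 1) * ‖Y - X‖ ≤ (K * c ^ 2 + 1) * (ε / (2 * (K * c ^ 2 + 1))) := by
        gcongr
      have h6 : (K * c ^ 2 + 1) * (ε / (2 * (K * c ^ 2 + 1))) = ε / 2 := by field_simp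
      nlinarith
    calc K * (c * ‖Y - X‖) ^ 2 = K * c ^ 2 * ‖Y - X‖ * ‖Y - X‖ := by ring
      _ ≤ _ := mul_le_mul_of_nonneg_right this n0
  linarith

end TraceFunction

/-! ### Schatten norms, symmetric dilation and duality -/

section Schatten

variable {m : ℕ}

/-- The sum of the `p`-th powers of the singular values. -/
def schattenSum (p : ℝ) (X : Mat m) : ℝ :=
  ∑ i : Fin m, (Matrix.toEuclideanLin X).singularValues i ^ p

theorem schattenNorm_eq (p : ℝ) (X : Mat m) : schattenNorm p X = schattenSum p X ^ (1 / p) := rfl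

theorem schattenSum_nonneg (p : ℝ) (X : Mat m) : 0 ≤ schattenSum p X :=
  Finset.sum_nonneg fun _ _ => Real.rpow_nonneg (LinearMap.singularValues_nonneg _ _) _

theorem schattenNorm_nonneg (p : ℝ) (X : Mat m) : 0 ≤ schattenNorm p X :=
  Real.rpow_nonneg (schattenSum_nonneg p X) _

theorem schattenNorm_rpow {p : ℝ} (hp : 0 < p) (X : Mat m) :
    schattenNorm p X ^ p = schattenSum p X := by
  rw [schattenNorm_eq, ← Real.rpow_mul (schattenSum_nonneg p X), one_div_mul_cancel hp.ne',
    Real.rpow_one]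

theorem sum_sq_singularValues (X : Mat m) (f : ℝ → ℝ) :
    ∑ i : Fin m, f ((Matrix.toEuclideanLin X).singularValues i ^ 2) =
      ((Xᵀ * X).charpoly.roots.map f).sum := by
  set T := Matrix.toEuclideanLin X with hT
  have hn : Module.finrank ℝ (EuclideanSpace ℝ (Fin m)) = m := finrank_euclideanSpace_fin
  have h1 := T.isSymmetric_adjoint_comp_self.roots_charpoly_eq_eigenvalues hn
  have h2 : T.adjoint ∘ₗ T = Matrix.toEuclideanLin (Xᵀ * X) := by
    rw [hT, ← Matrix.toEuclideanLin_conjTranspose_eq_adjoint,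
      Matrix.conjTranspose_eq_transpose_of_trivial]
    ext v i
    simp [Matrix.mulVec_mulVec]
  have h3 : (T.adjoint ∘ₗ T).charpoly = (Xᵀ * X).charpoly := by
    rw [h2]
    change (Matrix.toLpLin 2 2 (Xᵀ * X)).charpoly = _
    rw [Matrix.toLpLin_eq_toLin, Matrix.charpoly_toLin]
  rw [h3] at h1
  rw [h1]
  simp only [LinearMap.sq_singularValues_fin T hn]
  simp [List.sum_ofFn]

theorem schattenSum_eq (p : ℝ) (X : Mat m) :
    schattenSum p X = ((Xᵀ * X).charpoly.roots.map fun t => t ^ (p / 2)).sum := by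
  rw [← sum_sq_singularValues, schattenSum]
  refine Finset.sum_congr rfl fun i _ => ?_
  rw [← Real.rpow_natCast, ← Real.rpow_mul (LinearMap.singularValues_nonneg _ _)]
  congr 1; push_cast; ring

theorem sq_rpow_half (t p : ℝ) : (t ^ 2) ^ (p / 2) = |t| ^ p := by
  rw [← sq_abs, ← Real.rpow_natCast, ← Real.rpow_mul (abs_nonneg t)]
  congr 1; push_cast; ring

theorem SpectralDecomp.schattenSum_eq {U : Mat m} {x : Fin m → ℝ} {X : Mat m}
    (h : SpectralDecomp U x X) (p : ℝ) : schattenSum p X = ∑ i, |x i| ^ p := by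
  rw [MirrorCover.schattenSum_eq, h.isSymm.eq, ← h.mul_self.sum_eq fun t => t ^ (p / 2)]
  simp only [sq_rpow_half]

/-- The symmetric dilation of a square matrix. -/
def dilation (m : ℕ) : Mat m →ₗ[ℝ] Matrix (Fin m ⊕ Fin m) (Fin m ⊕ Fin m) ℝ where
  toFun X := Matrix.fromBlocks 0 X Xᵀ 0
  map_add' X Y := by simp [Matrix.fromBlocks_add]
  map_smul' t X := by simp [Matrix.fromBlocks_smul]

theorem dilation_apply (X : Mat m) : dilation m X = Matrix.fromBlocks 0 X Xᵀ 0 := rfl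

theorem isSymm_dilation (X : Mat m) : (dilation m X).IsSymm := by
  rw [Matrix.IsSymm, dilation_apply, Matrix.fromBlocks_transpose]; simp

theorem dilation_mul (X Y : Mat m) :
    dilation m X * dilation m Y = Matrix.fromBlocks (X * Yᵀ) 0 0 (Xᵀ * Y) := by
  simp [dilation_apply, Matrix.fromBlocks_multiply]

theorem trace_dilation_mul (X Y : Mat m) :
    (dilation m X * dilation m Y).trace = 2 * traceInner X Y := by
  have h1 : (X * Yᵀ).trace = (Xᵀ * Y).trace := by
    rw [← Matrix.trace_transpose, Matrix.transpose_mul, Matrix.transpose_transpose,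
      Matrix.trace_mul_comm]
  have h2 : (Matrix.fromBlocks (X * Yᵀ) 0 0 (Xᵀ * Y)).trace =
      (X * Yᵀ).trace + (Xᵀ * Y).trace := by
    simp [Matrix.trace, Fintype.sum_sum_type]
  rw [dilation_mul, h2, h1, traceInner, two_mul]

/-- The square of the dilation is block diagonal with blocks `X Xᵀ` and `Xᵀ X`, which share a
characteristic polynomial. Each singular value is thus counted twice, whence the factor `1 / 2`. -/
theorem SpectralDecomp.schattenSum_eq_of_dilation {U : Matrix (Fin m ⊕ Fin m) (Fin m ⊕ Fin m) ℝ}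
    {x : Fin m ⊕ Fin m → ℝ} {X : Mat m} (h : SpectralDecomp U x (dilation m X)) (p : ℝ) :
    schattenSum p X = ∑ i, 1 / 2 * |x i| ^ p := by
  have h1 := h.mul_self.sum_eq fun t => t ^ (p / 2)
  have h2 : (dilation m X * dilation m X).charpoly.roots =
      (Xᵀ * X).charpoly.roots + (Xᵀ * X).charpoly.roots := by
    rw [dilation_mul, Matrix.charpoly_fromBlocks_zero₁₂, Matrix.charpoly_mul_comm X Xᵀ,
      Polynomial.roots_mul]
    exact mul_ne_zero (Matrix.charpoly_monic _).ne_zero (Matrix.charpoly_monic _).ne_zero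
  rw [h2, Multiset.map_add, Multiset.sum_add, ← MirrorCover.schattenSum_eq] at h1
  simp only [sq_rpow_half] at h1
  rw [← Finset.mul_sum, h1]; ring

theorem traceInner_eq_sum (A U : Mat m) : traceInner A U = ∑ i, ∑ j, A i j * U i j := by
  rw [traceInner, Matrix.trace, Finset.sum_comm]
  refine Finset.sum_congr rfl fun i _ => ?_
  rw [Matrix.diag_apply, Matrix.mul_apply]
  rfl

theorem traceInner_smul (A U : Mat m) (t : ℝ) : traceInner A (t • U) = t * traceInner A U := by
  simp [traceInner]

theorem traceInner_sub (A U V : Mat m) :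
    traceInner A (U - V) = traceInner A U - traceInner A V := by
  simp [traceInner, Matrix.mul_sub]

theorem schattenSum_two (X : Mat m) : schattenSum 2 X = ∑ i, ∑ j, X i j ^ 2 := by
  obtain ⟨U, x, h⟩ := exists_spectralDecomp (M := Xᵀ * X) (by
    rw [Matrix.IsSymm, Matrix.transpose_mul, Matrix.transpose_transpose])
  rw [schattenSum_eq, ← h.sum_eq]
  have := h.trace
  rw [← traceInner, traceInner_eq_sum] at this
  simp only [div_self (two_ne_zero' ℝ), Real.rpow_one, ← this, sq]

theorem sum_sq_le_schattenNorm_sq {p : ℝ} (hp : 0 < p) (hp2 : p ≤ 2) (X : Mat m) :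
    ∑ i, ∑ j, X i j ^ 2 ≤ schattenNorm p X ^ 2 := by
  rw [← schattenSum_two, schattenSum]
  set s := fun i : Fin m => (Matrix.toEuclideanLin X).singularValues i with hs
  have hs0 : ∀ i, 0 ≤ s i := fun i => LinearMap.singularValues_nonneg _ _
  set R := schattenNorm p X with hR
  have hR0 : 0 ≤ R := schattenNorm_nonneg p X
  have hsR : ∀ i, s i ≤ R := fun i => by
    rw [← Real.rpow_le_rpow_iff (hs0 i) hR0 hp, hR, schattenNorm_rpow hp]
    exact Finset.single_le_sum (f := fun i => s i ^ p)
      (fun i _ => Real.rpow_nonneg (hs0 i) _) (Finset.mem_univ i)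
  have e : ∀ t : ℝ, 0 ≤ t → t ^ (2 : ℝ) = t ^ p * t ^ (2 - p) := fun t ht => by
    rw [← Real.rpow_add_of_nonneg ht hp.le (by linarith)]; ring_nf
  calc ∑ i, s i ^ (2 : ℝ) ≤ ∑ i, s i ^ p * R ^ (2 - p) := by
        refine Finset.sum_le_sum fun i _ => ?_
        rw [e _ (hs0 i)]
        exact mul_le_mul_of_nonneg_left (Real.rpow_le_rpow (hs0 i) (hsR i) (by linarith))
          (Real.rpow_nonneg (hs0 i) _)
    _ = R ^ 2 := by
        rw [← Finset.sum_mul, ← Real.rpow_two, e R hR0, hR, schattenNorm_rpow hp]; rfl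

theorem schattenNorm_smul {p : ℝ} (hp : 0 < p) (t : ℝ) (X : Mat m) :
    schattenNorm p (t • X) = |t| * schattenNorm p X := by
  obtain ⟨U, x, h⟩ := exists_spectralDecomp (isSymm_dilation X)
  have h' : SpectralDecomp U (fun i => t * x i) (dilation m (t • X)) := by
    rw [map_smul]; exact h.smul t
  rw [schattenNorm_eq, schattenNorm_eq, h.schattenSum_eq_of_dilation,
    h'.schattenSum_eq_of_dilation]
  have h0 : 0 ≤ ∑ i, 1 / 2 * |x i| ^ p := Finset.sum_nonneg fun i _ => by positivity
  have : ∑ i, 1 / 2 * |t * x i| ^ p = |t| ^ p * ∑ i, 1 / 2 * |x i| ^ p := by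
    rw [Finset.mul_sum]
    refine Finset.sum_congr rfl fun i _ => ?_
    rw [abs_mul, Real.mul_rpow (abs_nonneg _) (abs_nonneg _)]; ring
  rw [this, Real.mul_rpow (by positivity) h0, ← Real.rpow_mul (abs_nonneg t),
    mul_one_div_cancel hp.ne', Real.rpow_one]

theorem schattenNorm_zero {p : ℝ} (hp : 0 < p) : schattenNorm p (0 : Mat m) = 0 := by
  simpa using schattenNorm_smul hp 0 (0 : Mat m)

theorem eq_zero_of_schattenNorm {p : ℝ} (hp : 0 < p) (hp2 : p ≤ 2) {X : Mat m}
    (h : schattenNorm p X = 0) : X = 0 := by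
  have h1 := sum_sq_le_schattenNorm_sq hp hp2 X
  rw [h, zero_pow two_ne_zero] at h1
  ext i j
  have h2 : X i j ^ 2 ≤ ∑ i, ∑ j, X i j ^ 2 :=
    (Finset.single_le_sum (f := fun j => X i j ^ 2) (fun _ _ => sq_nonneg _)
      (Finset.mem_univ j)).trans
      (Finset.single_le_sum (f := fun i => ∑ j, X i j ^ 2)
        (fun _ _ => Finset.sum_nonneg fun _ _ => sq_nonneg _) (Finset.mem_univ i))
  have := pow_eq_zero_iff (two_ne_zero) |>.1 (le_antisymm (h2.trans h1) (sq_nonneg _))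
  simpa using this

theorem traceInner_sq_le (A U : Mat m) :
    traceInner A U ^ 2 ≤ (∑ i, ∑ j, A i j ^ 2) * ∑ i, ∑ j, U i j ^ 2 := by
  have := Finset.sum_mul_sq_le_sq_mul_sq (Finset.univ : Finset (Fin m × Fin m))
    (fun z => A z.1 z.2) (fun z => U z.1 z.2)
  simpa only [traceInner_eq_sum, Fintype.sum_prod_type] using this

theorem traceInner_le_schattenNorm {p : ℝ} (hp : 0 < p) (hp2 : p ≤ 2) {A : Mat m}
    (hA : dualNorm (schattenNorm p) A ≤ 1) (U : Mat m) : traceInner A U ≤ schattenNorm p U := by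
  -- A real `sSup` carries information only for a bounded set; boundedness follows from comparison
  -- with the Frobenius norm.
  have hbdd : BddAbove {r : ℝ | ∃ U : Mat m, schattenNorm p U ≤ 1 ∧ r = traceInner A U} := by
    refine ⟨1 + ∑ i, ∑ j, A i j ^ 2, ?_⟩
    rintro _ ⟨U, hU, rfl⟩
    have h1 := traceInner_sq_le A U
    have h2 := sum_sq_le_schattenNorm_sq hp hp2 U
    have h3 : schattenNorm p U ^ 2 ≤ 1 := pow_le_one₀ (schattenNorm_nonneg p U) hU
    have h4 : 0 ≤ ∑ i, ∑ j, A i j ^ 2 :=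
      Finset.sum_nonneg fun _ _ => Finset.sum_nonneg fun _ _ => sq_nonneg _
    nlinarith
  have unit : ∀ U : Mat m, schattenNorm p U ≤ 1 → traceInner A U ≤ 1 := fun U hU =>
    (le_csSup hbdd ⟨U, hU, rfl⟩).trans hA
  rcases (schattenNorm_nonneg p U).eq_or_lt with h | h
  · rw [eq_zero_of_schattenNorm hp hp2 h.symm, schattenNorm_zero hp]; simp [traceInner]
  · have h1 := unit ((schattenNorm p U)⁻¹ • U) (by
      rw [schattenNorm_smul hp, abs_of_pos (inv_pos.2 h), inv_mul_cancel₀ h.ne'])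
    rwa [traceInner_smul, inv_mul_le_iff₀ h, mul_one] at h1

theorem abs_traceInner_le_schattenNorm {p : ℝ} (hp : 0 < p) (hp2 : p ≤ 2) {A : Mat m}
    (hA : dualNorm (schattenNorm p) A ≤ 1) (U : Mat m) : |traceInner A U| ≤ schattenNorm p U := by
  rw [abs_le']
  refine ⟨traceInner_le_schattenNorm hp hp2 hA U, ?_⟩
  have h1 := traceInner_le_schattenNorm hp hp2 hA ((-1 : ℝ) • U)
  rw [traceInner_smul, schattenNorm_smul hp] at h1
  simpa using h1

namespace SpectralDecomp

variable {E A : Mat m} {a : Fin m → ℝ}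

/-- Testing only matrices diagonal in the eigenbasis of `A` reduces duality to vectors. -/
theorem sum_mul_le_of_dualNorm_le (e : SpectralDecomp E a A) {p : ℝ} (hp : 0 < p) (hp2 : p ≤ 2)
    (hA : dualNorm (schattenNorm p) A ≤ 1) (b : Fin m → ℝ) :
    ∑ i, b i * a i ≤ (∑ i, |b i| ^ p) ^ (1 / p) := by
  have h1 := traceInner_le_schattenNorm hp hp2 hA (E * Matrix.diagonal b * Eᵀ)
  rw [schattenNorm_eq, (e.mk' b).schattenSum_eq] at h1
  refine le_trans (le_of_eq ?_) h1
  rw [traceInner, e.isSymm.eq, e.trace_mul_conj]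
  exact Finset.sum_congr rfl fun i _ => mul_comm _ _

/-- The dual of the trace norm controls the operator norm. -/
theorem sq_le_one_of_dualNorm_le (e : SpectralDecomp E a A)
    (hA : dualNorm (schattenNorm 1) A ≤ 1) (i : Fin m) : a i ^ 2 ≤ 1 := by
  have h1 := e.sum_mul_le_of_dualNorm_le one_pos one_le_two hA (Pi.single i 1)
  have h2 := e.sum_mul_le_of_dualNorm_le one_pos one_le_two hA (Pi.single i (-1))
  have h3 : ∀ c : ℝ, |c| = 1 → ∑ j, |(Pi.single i c : Fin m → ℝ) j| = 1 := by
    intro c hc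
    rw [Finset.sum_eq_single i (fun j _ hj => by simp [hj]) (by simp)]
    simpa using hc
  simp only [Real.rpow_one, div_one, h3 1 (by simp), h3 (-1) (by simp)] at h1 h2
  simp [Pi.single_apply] at h1 h2
  rw [sq_le_one_iff_abs_le_one, abs_le]
  exact ⟨by linarith, h1⟩

/-- The dual of the Schatten-`p` norm controls the Schatten norm of the conjugate exponent. -/
theorem sum_rpow_le_one_of_dualNorm_le (e : SpectralDecomp E a A) {p : ℝ} (hp : 1 < p)
    (hp2 : p ≤ 2) (hA : dualNorm (schattenNorm p) A ≤ 1) :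
    ∑ i, |a i| ^ (p / (p - 1)) ≤ 1 := by
  have hp1 : 0 < p - 1 := by linarith
  set q := p / (p - 1) with hq
  set S := ∑ i, |a i| ^ q with hS
  have hq1 : 1 < q := by rw [hq, lt_div_iff₀ hp1]; linarith
  -- The Hölder extremizer: both sides become powers of `S`, giving `S ≤ S ^ (1 / p)` and hence `S ≤
  -- 1`.
  have h1 := e.sum_mul_le_of_dualNorm_le (by linarith) hp2 hA fun i => |a i| ^ (q - 2) * a i
  have habs : ∀ t : ℝ, |(|t| ^ (q - 2) * t)| = |t| ^ (q - 1) := by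
    intro t
    rw [abs_mul, abs_of_nonneg (Real.rpow_nonneg (abs_nonneg t) _)]
    rcases eq_or_ne t 0 with rfl | ht
    · simp [Real.zero_rpow (by linarith : q - 1 ≠ 0)]
    · rw [← Real.rpow_add_one (abs_pos.2 ht).ne']; ring_nf
  have h2 : ∑ i, |(|a i| ^ (q - 2) * a i)| ^ p = S := by
    refine Finset.sum_congr rfl fun i _ => ?_
    rw [habs, ← Real.rpow_mul (abs_nonneg _)]
    congr 1
    rw [hq]; field_simp; ring
  have h3 : ∑ i, |a i| ^ (q - 2) * a i * a i = S := by
    refine Finset.sum_congr rfl fun i _ => ?_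
    rcases eq_or_ne (a i) 0 with h0 | h0
    · simp [h0, Real.zero_rpow (by linarith : q ≠ 0)]
    · rw [mul_assoc, ← sq, ← sq_abs, ← Real.rpow_natCast, ← Real.rpow_add (abs_pos.2 h0)]
      congr 1; push_cast; ring
  rw [h2, h3] at h1
  by_contra! hlt
  have h4 : S ^ (1 / p) < S ^ (1 : ℝ) :=
    Real.rpow_lt_rpow_of_exponent_lt hlt (by rw [div_lt_one (by linarith)]; exact hp)
  rw [Real.rpow_one] at h4
  linarith

end SpectralDecomp

end Schatten

/-! ### The Schatten mirror map: derivative, strong convexity, minimizers -/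

section MirrorMap

attribute [local instance] Matrix.normedAddCommGroup Matrix.normedSpace

variable {m : ℕ}

theorem bregman_eq_of_hasFDerivAt {Φ : Mat m → ℝ} {X : Mat m} {L : Mat m →L[ℝ] ℝ}
    (h : HasFDerivAt Φ L X) (Y : Mat m) : bregman Φ Y X = Φ Y - Φ X - L (Y - X) := by
  rw [bregman, h.fderiv]

/-- The linear form `H ↦ ∑ i, c i * (Uᵀ H U) i i` on the dilations of matrices. -/
def dilationForm (U : Matrix (Fin m ⊕ Fin m) (Fin m ⊕ Fin m) ℝ) (c : Fin m ⊕ Fin m → ℝ) :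
    Mat m →L[ℝ] ℝ :=
  LinearMap.toContinuousLinearMap
    { toFun := fun H => ∑ i, c i * (Uᵀ * dilation m H * U) i i
      map_add' := fun H K => by
        simp only [map_add, Matrix.add_mul, Matrix.add_apply, mul_add,
          Finset.sum_add_distrib]
      map_smul' := fun t H => by
        simp only [map_smul, Matrix.mul_smul, Matrix.smul_mul, Matrix.smul_apply, smul_eq_mul,
          RingHom.id_apply, Finset.mul_sum, mul_left_comm] }

theorem dilationForm_apply (U : Matrix (Fin m ⊕ Fin m) (Fin m ⊕ Fin m) ℝ)
    (c : Fin m ⊕ Fin m → ℝ) (H : Mat m) :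
    dilationForm U c H = ∑ i, c i * (Uᵀ * dilation m H * U) i i := rfl

variable {U : Matrix (Fin m ⊕ Fin m) (Fin m ⊕ Fin m) ℝ} {x : Fin m ⊕ Fin m → ℝ} {X : Mat m}
  {p : ℝ}

theorem SpectralDecomp.hasFDerivAt_schattenSum (h : SpectralDecomp U x (dilation m X))
    (hp : 1 < p) (hp2 : p ≤ 2) :
    HasFDerivAt (schattenSum p)
      (dilationForm U fun i => 1 / 2 * (p * |x i| ^ (p - 2) * x i)) X := by
  refine hasFDerivAt_spectralSum (dilation m) isSymm_dilation (f := fun t => 1 / 2 * |t| ^ p)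
    (f' := fun t => 1 / 2 * (p * |t| ^ (p - 2) * t)) (C := 1) (fun t => ?_) _
    (fun Y V y k => k.schattenSum_eq_of_dilation p) h
    (fun i => (hasDerivAt_abs_rpow (x i) hp).const_mul _) _ (fun H => rfl)
  have := abs_rpow_le_one_add_sq (by linarith : 0 ≤ p) hp2 t
  rw [abs_mul]
  norm_num
  linarith [abs_nonneg (|t| ^ p)]

theorem schattenNorm_sq (X : Mat m) : schattenNorm p X ^ 2 = schattenSum p X ^ (2 / p) := by
  rw [schattenNorm_eq, ← Real.rpow_natCast, ← Real.rpow_mul (schattenSum_nonneg p X)]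
  congr 1; push_cast; ring

theorem SpectralDecomp.hasFDerivAt_schattenMirrorMap (h : SpectralDecomp U x (dilation m X))
    (hp : 1 < p) (hp2 : p ≤ 2) :
    HasFDerivAt (schattenMirrorMap p)
      ((1 / (2 * (p - 1))) • (2 / p * schattenSum p X ^ (2 / p - 1)) •
        dilationForm U fun i => 1 / 2 * (p * |x i| ^ (p - 2) * x i)) X := by
  have h1 : HasDerivAt (fun s : ℝ => s ^ (2 / p)) (2 / p * schattenSum p X ^ (2 / p - 1))
      (schattenSum p X) :=
    Real.hasDerivAt_rpow_const (Or.inr (by rw [le_div_iff₀ (by linarith)]; linarith))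
  have h2 := (h1.comp_hasFDerivAt X (h.hasFDerivAt_schattenSum hp hp2)).const_mul
    (1 / (2 * (p - 1)))
  refine h2.congr_of_eventuallyEq (Filter.Eventually.of_forall fun Y => ?_)
  simp only [schattenMirrorMap, schattenNorm_sq, Function.comp_apply]

/-- With `r = 2 / p`, this convexity passes lower bounds from the power sum to the squared norm. -/
theorem rpow_tangent_le {r s t : ℝ} (hr : 1 ≤ r) (hs : 0 ≤ s) (ht : 0 ≤ t) :
    t ^ r + r * t ^ (r - 1) * (s - t) ≤ s ^ r := by
  rcases ht.eq_or_lt with rfl | ht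
  · rcases hr.eq_or_lt with rfl | hr
    · simp
    · rw [Real.zero_rpow (by linarith), Real.zero_rpow (by linarith)]
      simpa using Real.rpow_nonneg hs r
  have b := one_add_mul_self_le_rpow_one_add (s := s / t - 1)
    (by have : 0 ≤ s / t := by positivity
        linarith) hr
  rw [add_sub_cancel, Real.div_rpow hs ht.le, le_div_iff₀ (by positivity)] at b
  refine le_trans (le_of_eq ?_) b
  rw [Real.rpow_sub_one ht.ne']
  field_simp

/-- The quadratic lower bound for the Bregman divergence of the Schatten power sum. -/
theorem SpectralDecomp.schattenSum_remainder_ge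
    {V : Matrix (Fin m ⊕ Fin m) (Fin m ⊕ Fin m) ℝ} {y : Fin m ⊕ Fin m → ℝ} {Y : Mat m}
    (h : SpectralDecomp U x (dilation m X)) (k : SpectralDecomp V y (dilation m Y))
    (hp : 1 < p) (hp2 : p ≤ 2) :
    p * (p - 1) / 4 * ∑ i, ∑ j, (Uᵀ * V) i j ^ 2 *
        ((y j - x i) ^ 2 * (|x i| + |y j|) ^ (p - 2)) ≤
      schattenSum p Y - schattenSum p X -
        dilationForm U (fun i => 1 / 2 * (p * |x i| ^ (p - 2) * x i)) (Y - X) := by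
  rw [h.schattenSum_eq_of_dilation, k.schattenSum_eq_of_dilation, dilationForm_apply, map_sub,
    h.sum_sub_sum_sub k (fun t => 1 / 2 * |t| ^ p) (fun t => 1 / 2 * (p * |t| ^ (p - 2) * t)),
    Finset.mul_sum]
  refine Finset.sum_le_sum fun i _ => ?_
  rw [Finset.mul_sum]
  refine Finset.sum_le_sum fun j _ => ?_
  have h1 := abs_rpow_remainder_ge hp hp2 (x i) (y j)
  have h2 := mul_le_mul_of_nonneg_left h1 (sq_nonneg ((Uᵀ * V) i j))
  nlinarith

/-- Euler's identity for a `p`-homogeneous function. -/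
theorem SpectralDecomp.dilationForm_self (h : SpectralDecomp U x (dilation m X)) (hp : 1 < p) :
    dilationForm U (fun i => 1 / 2 * (p * |x i| ^ (p - 2) * x i)) X = p * schattenSum p X := by
  rw [dilationForm_apply, h.schattenSum_eq_of_dilation, Finset.mul_sum]
  refine Finset.sum_congr rfl fun i _ => ?_
  rw [h.conj_self_apply]
  rcases eq_or_ne (x i) 0 with h0 | h0
  · simp [h0, Real.zero_rpow (by linarith : p ≠ 0)]
  · have : |x i| ^ p = |x i| ^ (p - 2) * x i ^ 2 := by
      rw [← sq_abs (x i), ← Real.rpow_natCast, ← Real.rpow_add (abs_pos.2 h0)]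
      congr 1; push_cast; ring
    rw [this]; ring

/-- Young's inequality summed against a doubly stochastic array. -/
theorem sum_weight_mul_le {ι : Type*} [Fintype ι] (hp : 1 < p) (hp2 : p ≤ 2) {w : ι → ι → ℝ}
    (hw : ∀ i j, 0 ≤ w i j) (hrow : ∀ i, ∑ j, w i j = 1) (hcol : ∀ j, ∑ i, w i j = 1)
    {x a : ι → ℝ} {R c : ℝ} (hR : 0 < R) (hx : ∑ i, |x i| ^ p ≤ c * R ^ p)
    (ha : ∑ j, |a j| ^ (p / (p - 1)) ≤ c) :
    ∑ i, ∑ j, w i j * (|x i| ^ (2 - p) * a j ^ 2) ≤ c * R ^ (2 - p) := by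
  have hp0 : 0 < p := by linarith
  have hp1 : 0 < p - 1 := by linarith
  -- Young exponents chosen so that `(|x| ^ p) ^ α = |x| ^ (2 - p)` and `(|a| ^ (p / (p - 1))) ^ β =
  -- a ^ 2`.
  set α := (2 - p) / p with hα
  set β := 2 * (p - 1) / p with hβ
  have hα0 : 0 ≤ α := div_nonneg (by linarith) hp0.le
  have hβ0 : 0 ≤ β := by positivity
  have hαβ : α + β = 1 := by rw [hα, hβ]; field_simp; ring
  have term : ∀ i j, |x i| ^ (2 - p) * a j ^ 2 ≤
      R ^ (2 - p) * (α * (|x i| ^ p / R ^ p) + β * |a j| ^ (p / (p - 1))) := by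
    intro i j
    have h1 := Real.geom_mean_le_arith_mean2_weighted hα0 hβ0
      (p₁ := |x i| ^ p / R ^ p) (p₂ := |a j| ^ (p / (p - 1))) (by positivity) (by positivity) hαβ
    have h2 : (|x i| ^ p / R ^ p) ^ α = |x i| ^ (2 - p) / R ^ (2 - p) := by
      rw [← Real.div_rpow (abs_nonneg _) hR.le, ← Real.rpow_mul (by positivity),
        Real.div_rpow (abs_nonneg _) hR.le]
      congr 2 <;> rw [hα] <;> field_simp
    have h3 : (|a j| ^ (p / (p - 1))) ^ β = a j ^ 2 := by
      rw [← Real.rpow_mul (abs_nonneg _), ← sq_abs (a j), ← Real.rpow_natCast]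
      congr 1; rw [hβ]; push_cast; field_simp
    rw [h2, h3] at h1
    have h4 := mul_le_mul_of_nonneg_left h1 (Real.rpow_nonneg hR.le (2 - p))
    refine le_trans (le_of_eq ?_) h4
    field_simp
  calc ∑ i, ∑ j, w i j * (|x i| ^ (2 - p) * a j ^ 2)
      ≤ ∑ i, ∑ j, (R ^ (2 - p) * α / R ^ p * (w i j * |x i| ^ p) +
          R ^ (2 - p) * β * (w i j * |a j| ^ (p / (p - 1)))) := by
        refine Finset.sum_le_sum fun i _ => Finset.sum_le_sum fun j _ => ?_
        refine (mul_le_mul_of_nonneg_left (term i j) (hw i j)).trans (le_of_eq ?_)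
        ring
    _ = R ^ (2 - p) * α / R ^ p * ∑ i, |x i| ^ p +
          R ^ (2 - p) * β * ∑ j, |a j| ^ (p / (p - 1)) := by
        simp only [Finset.sum_add_distrib, ← Finset.mul_sum]
        congr 2
        · simp only [← Finset.sum_mul, hrow, one_mul]
        · rw [Finset.sum_comm]
          simp only [← Finset.sum_mul, hcol, one_mul]
    _ ≤ R ^ (2 - p) * α / R ^ p * (c * R ^ p) + R ^ (2 - p) * β * c := by gcongr
    _ = (α + β) * (c * R ^ (2 - p)) := by
        field_simp
    _ = _ := by rw [hαβ, one_mul]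

/-- The weighted Cauchy–Schwarz bound when `Y` is not much larger than `X`. -/
theorem SpectralDecomp.traceInner_sub_sq_le
    {V : Matrix (Fin m ⊕ Fin m) (Fin m ⊕ Fin m) ℝ} {y : Fin m ⊕ Fin m → ℝ} {A Y : Mat m}
    (h : SpectralDecomp U x (dilation m X)) (k : SpectralDecomp V y (dilation m Y))
    (hp : 1 < p) (hp2 : p ≤ 2) (hA : A.IsSymm) (hA1 : dualNorm (schattenNorm p) A ≤ 1)
    (hX : 0 < schattenNorm p X) (hY : schattenNorm p Y ≤ 4 * schattenNorm p X) :
    traceInner A (Y - X) ^ 2 ≤ 5 / 2 * schattenNorm p X ^ (2 - p) *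
      ∑ i, ∑ j, (Uᵀ * V) i j ^ 2 * ((y j - x i) ^ 2 * (|x i| + |y j|) ^ (p - 2)) := by
  have hp0 : 0 < p := by linarith
  set R := schattenNorm p X with hR
  obtain ⟨E₀, a₀, e₀⟩ := exists_spectralDecomp hA
  obtain ⟨E, a, e⟩ := exists_spectralDecomp (isSymm_dilation A)
  have ha : ∑ j, |a j| ^ (p / (p - 1)) ≤ 2 := by
    have h1 := e₀.sum_rpow_le_one_of_dualNorm_le hp hp2 hA1
    rw [← e₀.schattenSum_eq, e.schattenSum_eq_of_dilation, ← Finset.mul_sum] at h1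
    linarith
  have hx : ∑ i, |x i| ^ p ≤ 2 * R ^ p := by
    rw [hR, schattenNorm_rpow hp0, h.schattenSum_eq_of_dilation, ← Finset.mul_sum]; linarith
  have hy : ∑ i, |y i| ^ p ≤ 2 * (4 * R) ^ p := by
    have h1 := Real.rpow_le_rpow (schattenNorm_nonneg p Y) hY hp0.le
    rw [schattenNorm_rpow hp0, k.schattenSum_eq_of_dilation, ← Finset.mul_sum] at h1
    linarith
  have hcs := h.trace_mul_sub_sq_le k e
    (κ := fun i j => (|x i| + |y j|) ^ (2 - p)) (l := fun i j => (|x i| + |y j|) ^ (p - 2))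
    (α := fun i => |x i| ^ (2 - p)) (β := fun j => |y j| ^ (2 - p))
    (fun i j => by positivity) (fun i j => by positivity)
    (fun i j hij => by
      have hpos : 0 < |x i| + |y j| := by
        rcases eq_or_ne (x i) 0 with h0 | h0
        · have : y j ≠ 0 := by rwa [h0] at hij
          positivity
        · positivity
      rw [← Real.rpow_add hpos]; simp)
    (fun i j => Real.rpow_add_le_add_rpow (abs_nonneg _) (abs_nonneg _) (by linarith)
      (by linarith))
  rw [← map_sub, trace_dilation_mul] at hcs
  have b1 := sum_weight_mul_le hp hp2 (fun i j => sq_nonneg ((Uᵀ * E) i j))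
    (h.sum_overlap_row e) (h.sum_overlap_col e) hX hx ha
  have b2 := sum_weight_mul_le hp hp2 (fun i j => sq_nonneg ((Vᵀ * E) i j))
    (k.sum_overlap_row e) (k.sum_overlap_col e) (by positivity : 0 < 4 * R) hy ha
  have b3 : (4 * R) ^ (2 - p) ≤ 4 * R ^ (2 - p) := by
    rw [Real.mul_rpow (by norm_num) hX.le]
    refine mul_le_mul_of_nonneg_right ?_ (by positivity)
    calc (4 : ℝ) ^ (2 - p) ≤ 4 ^ (1 : ℝ) :=
          Real.rpow_le_rpow_of_exponent_le (by norm_num) (by linarith)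
      _ = 4 := Real.rpow_one _
  set Q := ∑ i, ∑ j, (Uᵀ * V) i j ^ 2 * ((y j - x i) ^ 2 * (|x i| + |y j|) ^ (p - 2)) with hQ
  have hQ0 : 0 ≤ Q := Finset.sum_nonneg fun i _ => Finset.sum_nonneg fun j _ => by positivity
  -- The dilation doubles the trace pairing, so the left side is four times the square; the two
  -- weights contribute `2 + 8`, giving `10 / 4 = 5 / 2`.
  have h5 := hcs.trans (mul_le_mul_of_nonneg_left
    (add_le_add b1 (b2.trans (mul_le_mul_of_nonneg_left b3 two_pos.le))) hQ0)
  nlinarith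

/-- Strong convexity of the Schatten mirror map, tested against the dual unit ball. -/
theorem bregman_schattenMirrorMap_ge {A : Mat m} (hp : 1 < p) (hp2 : p ≤ 2) (hA : A.IsSymm)
    (hA1 : dualNorm (schattenNorm p) A ≤ 1) (Y X : Mat m) :
    1 / 10 * (traceInner A Y - traceInner A X) ^ 2 ≤ bregman (schattenMirrorMap p) Y X := by
  have hp0 : 0 < p := by linarith
  have hp1 : 0 < p - 1 := by linarith
  obtain ⟨U, x, h⟩ := exists_spectralDecomp (isSymm_dilation X)
  rw [bregman_eq_of_hasFDerivAt (h.hasFDerivAt_schattenMirrorMap hp hp2), ← traceInner_sub]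
  set L := dilationForm U fun i => 1 / 2 * (p * |x i| ^ (p - 2) * x i) with hL
  set c := 2 / p * schattenSum p X ^ (2 / p - 1) with hc
  have hg0 := schattenSum_nonneg p X
  have hc0 : 0 ≤ c := by positivity
  have hr : 1 ≤ 2 / p := by rw [le_div_iff₀ hp0]; linarith
  have e1 : ∀ Z, c * (schattenSum p Z - schattenSum p X - L (Z - X)) ≤
      schattenNorm p Z ^ 2 - schattenNorm p X ^ 2 - c * L (Z - X) := by
    intro Z
    have := rpow_tangent_le hr (schattenSum_nonneg p Z) hg0
    rw [schattenNorm_sq, schattenNorm_sq]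
    linarith
  have e2 : schattenMirrorMap p Y - schattenMirrorMap p X -
      ((1 / (2 * (p - 1))) • c • L) (Y - X) =
      1 / (2 * (p - 1)) * (schattenNorm p Y ^ 2 - schattenNorm p X ^ 2 - c * L (Y - X)) := by
    simp only [schattenMirrorMap, smul_apply, smul_eq_mul]
    ring
  rw [e2]
  have hpos : ∀ Z, 0 ≤ schattenNorm p Z ^ 2 - schattenNorm p X ^ 2 - c * L (Z - X) := by
    intro Z
    obtain ⟨V, z, k⟩ := exists_spectralDecomp (isSymm_dilation Z)
    refine le_trans (mul_nonneg hc0 (le_trans ?_ (h.schattenSum_remainder_ge k hp hp2))) (e1 Z)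
    refine mul_nonneg (by positivity) ?_
    exact Finset.sum_nonneg fun i _ => Finset.sum_nonneg fun j _ => by positivity
  have hNX := schattenNorm_nonneg p X
  have hNY := schattenNorm_nonneg p Y
  -- For `Y` comparable to `X` the local quadratic bound suffices. For much larger `Y` it degrades,
  -- and `(‖Y‖ - ‖X‖)²` is already comparable to `(‖Y‖ + ‖X‖)²`.
  rcases le_or_gt (schattenNorm p Y) (4 * schattenNorm p X) with hYX | hYX
  · rcases hNX.eq_or_lt with h0 | h0
    · have hX : X = 0 := eq_zero_of_schattenNorm hp0 hp2 h0.symm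
      have hY : Y = 0 := eq_zero_of_schattenNorm hp0 hp2 (by linarith)
      have : traceInner A (Y - X) = 0 := by simp [hX, hY, traceInner]
      rw [this]
      have := mul_nonneg (by positivity : 0 ≤ 1 / (2 * (p - 1))) (hpos Y)
      simpa using this
    obtain ⟨V, y, k⟩ := exists_spectralDecomp (isSymm_dilation Y)
    have b1 := h.traceInner_sub_sq_le k hp hp2 hA hA1 h0 hYX
    have b2 := h.schattenSum_remainder_ge k hp hp2
    have b3 := e1 Y
    have hcN : c = 2 / p * schattenNorm p X ^ (2 - p) := by
      rw [hc, ← schattenNorm_rpow hp0, ← Real.rpow_mul hNX]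
      congr 2; field_simp
    set Q := ∑ i, ∑ j, (Uᵀ * V) i j ^ 2 * ((y j - x i) ^ 2 * (|x i| + |y j|) ^ (p - 2)) with hQ
    have b4 : c * (p * (p - 1) / 4 * Q) ≤
        schattenNorm p Y ^ 2 - schattenNorm p X ^ 2 - c * L (Y - X) :=
      (mul_le_mul_of_nonneg_left b2 hc0).trans b3
    have b5 : 1 / (2 * (p - 1)) * (c * (p * (p - 1) / 4 * Q)) =
        1 / 4 * (schattenNorm p X ^ (2 - p) * Q) := by
      rw [hcN]; field_simp
    have b6 := mul_le_mul_of_nonneg_left b4 (by positivity : 0 ≤ 1 / (2 * (p - 1)))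
    rw [b5] at b6
    linarith
  · have hLX : c * L X = 2 * schattenNorm p X ^ 2 := by
      rw [hL, h.dilationForm_self hp, schattenNorm_sq, hc]
      rcases hg0.eq_or_lt with h0 | h0
      · rw [← h0, Real.zero_rpow (div_pos two_pos hp0).ne']; simp
      · rw [Real.rpow_sub_one h0.ne']; field_simp
    -- Convexity along the line through `Y` yields the dual norm bound on the gradient by a
    -- discriminant, without a Hölder inequality for matrices.
    have hquad : ∀ t : ℝ, 0 ≤ schattenNorm p Y ^ 2 * (t * t) + (-(c * L Y)) * t +
        schattenNorm p X ^ 2 := by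
      intro t
      have := hpos (t • Y)
      rw [schattenNorm_smul hp0, mul_pow, sq_abs, map_sub, map_smul, smul_eq_mul] at this
      nlinarith
    have hdisc := discrim_le_zero hquad
    have hLY : c * L Y ≤ 2 * schattenNorm p X * schattenNorm p Y := by
      refine (abs_le_of_sq_le_sq' ?_ (by positivity)).2
      rw [discrim] at hdisc
      nlinarith
    have b1 : (schattenNorm p Y - schattenNorm p X) ^ 2 ≤
        schattenNorm p Y ^ 2 - schattenNorm p X ^ 2 - c * L (Y - X) := by
      rw [map_sub]; nlinarith
    have b2 : |traceInner A (Y - X)| ≤ schattenNorm p Y + schattenNorm p X := by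
      rw [traceInner_sub]
      exact (abs_sub _ _).trans (add_le_add (abs_traceInner_le_schattenNorm hp0 hp2 hA1 _)
        (abs_traceInner_le_schattenNorm hp0 hp2 hA1 _))
    have b3 : traceInner A (Y - X) ^ 2 ≤ (schattenNorm p Y + schattenNorm p X) ^ 2 := by
      rw [← sq_abs]; exact pow_le_pow_left₀ (abs_nonneg _) b2 2
    have b4 : 1 / 2 ≤ 1 / (2 * (p - 1)) := by
      apply one_div_le_one_div_of_le <;> linarith
    have b5 := mul_le_mul b4 b1 (sq_nonneg _) (by positivity)
    refine le_trans ?_ b5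
    nlinarith

/-- Quadratic growth beats the linear term, so a minimizer exists. There the derivative of the
mirror map equals `θ`, which makes the gap exactly a Bregman divergence. -/
theorem exists_schattenMirrorMap_minimizer (hp : 1 < p) (hp2 : p ≤ 2) (θ : Mat m →L[ℝ] ℝ) :
    ∃ V : Mat m, ∀ W, bregman (schattenMirrorMap p) W V =
      (schattenMirrorMap p W - θ W) - (schattenMirrorMap p V - θ V) := by
  have hp0 : 0 < p := by linarith
  have hdiff : ∀ X : Mat m, ∃ L : Mat m →L[ℝ] ℝ, HasFDerivAt (schattenMirrorMap p) L X := by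
    intro X
    obtain ⟨U, x, h⟩ := exists_spectralDecomp (isSymm_dilation X)
    exact ⟨_, h.hasFDerivAt_schattenMirrorMap hp hp2⟩
  choose L hL using hdiff
  have hcont : Continuous fun X : Mat m => schattenMirrorMap p X - θ X :=
    (continuous_iff_continuousAt.2 fun X => (hL X).continuousAt).sub θ.continuous
  have hge : ∀ X : Mat m, 1 / 2 * ‖X‖ ^ 2 ≤ schattenMirrorMap p X := by
    intro X
    have h1 : ‖X‖ ≤ schattenNorm p X := by
      rw [Matrix.norm_le_iff (schattenNorm_nonneg p X)]
      intro i j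
      refine abs_le_of_sq_le_sq ?_ (schattenNorm_nonneg p X)
      refine le_trans ?_ (sum_sq_le_schattenNorm_sq hp0 hp2 X)
      exact (Finset.single_le_sum (f := fun j => X i j ^ 2) (fun _ _ => sq_nonneg _)
        (Finset.mem_univ j)).trans
        (Finset.single_le_sum (f := fun i => ∑ j, X i j ^ 2)
          (fun _ _ => Finset.sum_nonneg fun _ _ => sq_nonneg _) (Finset.mem_univ i))
    have h2 : 1 / 2 ≤ 1 / (2 * (p - 1)) := by
      apply one_div_le_one_div_of_le <;> linarith
    exact mul_le_mul h2 (pow_le_pow_left₀ (norm_nonneg X) h1 2) (by positivity)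
      (by linarith)
  obtain ⟨C, hC0, hC⟩ := SemilinearMapClass.bound_of_continuous θ θ.continuous
  obtain ⟨V, hV⟩ := hcont.exists_forall_le' (0 : Mat m) (by
    filter_upwards [(tendsto_norm_cocompact_atTop (E := Mat m)).eventually_ge_atTop
      (2 * C)] with X hX
    have h0 : schattenMirrorMap p (0 : Mat m) = 0 := by
      rw [schattenMirrorMap, schattenNorm_zero hp0]; simp
    have h1 : θ X ≤ C * ‖X‖ := (le_abs_self _).trans (hC X)
    have h2 := hge X
    simp only [h0, map_zero, sub_zero]
    nlinarith [norm_nonneg X])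
  refine ⟨V, fun W => ?_⟩
  have hmin : IsLocalMin (fun X : Mat m => schattenMirrorMap p X - θ X) V :=
    Filter.Eventually.of_forall hV
  have h1 := hmin.hasFDerivAt_eq_zero ((hL V).sub θ.hasFDerivAt)
  have h2 : L V = θ := sub_eq_zero.1 h1
  rw [bregman_eq_of_hasFDerivAt (hL V), h2, map_sub]
  ring

end MirrorMap

/-! ### The entropy mirror map on the spectraplex -/

section Entropy

variable {m : ℕ}

theorem isSymm_coe (X : SymMat m) : (X : Mat m).IsSymm := by
  have : star (X : Mat m) = X := X.2
  rw [Matrix.star_eq_conjTranspose,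
    Matrix.conjTranspose_eq_transpose_of_trivial] at this
  exact this

theorem SpectralDecomp.map_eq_eigenvalues {U M : Mat m} {x : Fin m → ℝ}
    (h : SpectralDecomp U x M) (hM : M.IsHermitian) :
    Finset.univ.val.map x = Finset.univ.val.map hM.eigenvalues := by
  rw [← h.roots_charpoly, ← (spectralDecomp_of_isHermitian hM).roots_charpoly]

theorem SpectralDecomp.posDef_iff {U M : Mat m} {x : Fin m → ℝ} (h : SpectralDecomp U x M) :
    M.PosDef ↔ ∀ i, 0 < x i := by
  have hH : M.IsHermitian := by
    rw [Matrix.IsHermitian, Matrix.conjTranspose_eq_transpose_of_trivial]; exact h.isSymm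
  have e := h.map_eq_eigenvalues hH
  rw [hH.posDef_iff_eigenvalues_pos]
  have h1 : (∀ i, 0 < x i) ↔ ∀ t ∈ Finset.univ.val.map x, 0 < t := by simp
  rw [h1, e]
  simp

theorem SpectralDecomp.entropyMirrorMap_eq {X : SymMat m} {U : Mat m} {x : Fin m → ℝ}
    (h : SpectralDecomp U x (X : Mat m)) : entropyMirrorMap X = ∑ i, x i * Real.log (x i) := by
  have hH : (X : Mat m).IsHermitian := by
    rw [Matrix.IsHermitian, Matrix.conjTranspose_eq_transpose_of_trivial]; exact h.isSymm
  have hE := spectralDecomp_of_isHermitian hH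
  have h1 : cfc Real.log (X : Mat m) = (hH.eigenvectorUnitary : Mat m) *
      Matrix.diagonal (fun i => Real.log (hH.eigenvalues i)) *
        (hH.eigenvectorUnitary : Mat m)ᵀ := by
    rw [hH.cfc_eq, Matrix.IsHermitian.cfc, Unitary.conjStarAlgAut_apply,
      Matrix.star_eq_conjTranspose, Matrix.conjTranspose_eq_transpose_of_trivial]
    rfl
  rw [entropyMirrorMap, h1, hE.trace_mul_conj, h.sum_eq fun t => t * Real.log t,
    ← hE.sum_eq fun t => t * Real.log t]

/-- The linear form `H ↦ tr (Θ H)` on symmetric matrices. -/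
def traceForm (Θ : Mat m) : SymMat m →L[ℝ] ℝ :=
  LinearMap.toContinuousLinearMap
    { toFun := fun H => (Θ * (H : Mat m)).trace
      map_add' := fun H K => by
        simp only [Submodule.coe_add, Matrix.mul_add, Matrix.trace_add]
      map_smul' := fun t H => by
        simp only [Submodule.coe_smul, Matrix.mul_smul, Matrix.trace_smul, RingHom.id_apply] }

theorem traceForm_apply (Θ : Mat m) (H : SymMat m) :
    traceForm Θ H = (Θ * (H : Mat m)).trace := rfl

section Derivative

attribute [local instance] Matrix.normedAddCommGroup Matrix.normedSpace

theorem SpectralDecomp.hasFDerivAt_entropyMirrorMap {X : SymMat m} {U : Mat m} {x : Fin m → ℝ}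
    (h : SpectralDecomp U x (X : Mat m)) (hx : ∀ i, 0 < x i) :
    HasFDerivAt (entropyMirrorMap (m := m))
      (traceForm (U * Matrix.diagonal (fun i => Real.log (x i) + 1) * Uᵀ)) X :=
  hasFDerivAt_spectralSum (selfAdjoint.submodule ℝ (Mat m)).subtype isSymm_coe
    (f := fun t => t * Real.log t) (f' := fun t => Real.log t + 1) (C := 1) abs_mul_log_le _
    (fun _ _ _ k => k.entropyMirrorMap_eq) h
    (fun i => Real.hasDerivAt_mul_log (hx i).ne') _
    (fun H => (SpectralDecomp.sum_mul_conj_apply U H _).symm)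

theorem SpectralDecomp.bregman_entropyMirrorMap {X : SymMat m} {U : Mat m} {x : Fin m → ℝ}
    (h : SpectralDecomp U x (X : Mat m)) (hx : ∀ i, 0 < x i) (Y : SymMat m) :
    bregman entropyMirrorMap Y X = entropyMirrorMap Y - entropyMirrorMap X -
      traceForm (U * Matrix.diagonal (fun i => Real.log (x i) + 1) * Uᵀ) (Y - X) := by
  rw [bregman, (h.hasFDerivAt_entropyMirrorMap hx).fderiv]

end Derivative

theorem sum_weight_mul_le_of_sq_le_one {w : Fin m → Fin m → ℝ} (hw : ∀ i j, 0 ≤ w i j)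
    (hrow : ∀ i, ∑ j, w i j = 1) {x a : Fin m → ℝ} (hx : ∀ i, 0 ≤ x i)
    (ha : ∀ j, a j ^ 2 ≤ 1) : ∑ i, ∑ j, w i j * (x i * a j ^ 2) ≤ ∑ i, x i := by
  refine Finset.sum_le_sum fun i _ => ?_
  calc ∑ j, w i j * (x i * a j ^ 2) ≤ ∑ j, w i j * x i := by
        refine Finset.sum_le_sum fun j _ => mul_le_mul_of_nonneg_left ?_ (hw i j)
        nlinarith [hx i, ha j]
    _ = x i := by rw [← Finset.sum_mul, hrow, one_mul]

/-- A form of the quantum Pinsker inequality. -/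
theorem bregman_entropyMirrorMap_ge {A : Mat m} (hA : A.IsSymm)
    (hA1 : dualNorm (schattenNorm 1) A ≤ 1) {Y X : SymMat m}
    (hY : Y ∈ spectraplex m ∩ posDefMatrices m) (hX : X ∈ spectraplex m ∩ posDefMatrices m) :
    1 / 10 * (traceInner A Y - traceInner A X) ^ 2 ≤ bregman entropyMirrorMap Y X := by
  obtain ⟨U, x, h⟩ := exists_spectralDecomp (isSymm_coe X)
  obtain ⟨V, y, k⟩ := exists_spectralDecomp (isSymm_coe Y)
  obtain ⟨E, a, e⟩ := exists_spectralDecomp hA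
  have hx : ∀ i, 0 < x i := h.posDef_iff.1 hX.2
  have hy : ∀ i, 0 < y i := k.posDef_iff.1 hY.2
  have ha : ∀ i, a i ^ 2 ≤ 1 := e.sq_le_one_of_dualNorm_le hA1
  have hx1 : ∑ i, x i = 1 := h.trace ▸ hX.1.2
  have hy1 : ∑ i, y i = 1 := k.trace ▸ hY.1.2
  rw [h.bregman_entropyMirrorMap hx, traceForm_apply, ← SpectralDecomp.sum_mul_conj_apply,
    h.entropyMirrorMap_eq, k.entropyMirrorMap_eq, Submodule.coe_sub,
    h.sum_sub_sum_sub k (fun t => t * Real.log t) (fun t => Real.log t + 1), ← traceInner_sub,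
    traceInner, hA.eq]
  have hcs := h.trace_mul_sub_sq_le k e (κ := fun i j => x i + y j)
    (l := fun i j => (x i + y j)⁻¹) (α := x) (β := y)
    (fun i j => (add_pos (hx i) (hy j)).le) (fun i j => inv_nonneg.2 (add_pos (hx i) (hy j)).le)
    (fun i j _ => mul_inv_cancel₀ (add_pos (hx i) (hy j)).ne') (fun i j => le_rfl)
  have b1 := sum_weight_mul_le_of_sq_le_one (fun i j => sq_nonneg ((Uᵀ * E) i j))
    (h.sum_overlap_row e) (fun i => (hx i).le) ha
  have b2 := sum_weight_mul_le_of_sq_le_one (fun i j => sq_nonneg ((Vᵀ * E) i j))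
    (k.sum_overlap_row e) (fun i => (hy i).le) ha
  set Q := ∑ i, ∑ j, (Uᵀ * V) i j ^ 2 * ((y j - x i) ^ 2 * (x i + y j)⁻¹) with hQ
  have hQ0 : 0 ≤ Q := Finset.sum_nonneg fun i _ => Finset.sum_nonneg fun j _ =>
    mul_nonneg (sq_nonneg _) (mul_nonneg (sq_nonneg _) (inv_nonneg.2 (add_pos (hx i) (hy j)).le))
  have b3 : 1 / 2 * Q ≤ ∑ i, ∑ j, (Uᵀ * V) i j ^ 2 * (y j * Real.log (y j) -
      x i * Real.log (x i) - (Real.log (x i) + 1) * (y j - x i)) := by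
    rw [hQ, Finset.mul_sum]
    refine Finset.sum_le_sum fun i _ => ?_
    rw [Finset.mul_sum]
    refine Finset.sum_le_sum fun j _ => ?_
    have := mul_le_mul_of_nonneg_left (entropy_remainder_ge (hx i) (hy j))
      (sq_nonneg ((Uᵀ * V) i j))
    linarith
  -- Both traces are one, so the squared pairing is at most `2 Q`; this yields the constant `1 / 4`,
  -- better than the required `1 / 10`.
  have b4 := hcs.trans (mul_le_mul_of_nonneg_left (add_le_add b1 b2) hQ0)
  rw [hx1, hy1] at b4
  linarith

/-- The Gibbs state of a symmetric matrix minimizes the tilted entropy on the spectraplex. -/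
theorem exists_entropyMirrorMap_minimizer (hm : Nonempty (Fin m)) {Θ : Mat m} (hΘ : Θ.IsSymm) :
    ∃ V ∈ spectraplex m ∩ posDefMatrices m, ∀ W ∈ spectraplex m ∩ posDefMatrices m,
      bregman entropyMirrorMap W V =
        (entropyMirrorMap W - traceForm Θ W) - (entropyMirrorMap V - traceForm Θ V) := by
  obtain ⟨P, t, h⟩ := exists_spectralDecomp hΘ
  set Z := ∑ i, Real.exp (t i) with hZ
  have hZ0 : 0 < Z := Finset.sum_pos (fun i _ => Real.exp_pos _) Finset.univ_nonempty
  set v : Fin m → ℝ := fun i => Real.exp (t i) / Z with hv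
  have hv0 : ∀ i, 0 < v i := fun i => div_pos (Real.exp_pos _) hZ0
  have k := h.mk' v
  let V : SymMat m := ⟨P * Matrix.diagonal v * Pᵀ, by
    change star (P * Matrix.diagonal v * Pᵀ) = _
    rw [Matrix.star_eq_conjTranspose, Matrix.conjTranspose_eq_transpose_of_trivial]
    exact k.isSymm⟩
  have hPD : (V : Mat m).PosDef := k.posDef_iff.2 hv0
  have htr : (V : Mat m).trace = 1 := by
    rw [SpectralDecomp.trace (M := (V : Mat m)) k, hv, ← Finset.sum_div, div_self hZ0.ne']
  refine ⟨V, ⟨⟨hPD.posSemidef, htr⟩, hPD⟩, fun W hW => ?_⟩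
  rw [SpectralDecomp.bregman_entropyMirrorMap (X := V) k hv0]
  have h1 : Matrix.diagonal (fun i => Real.log (v i) + 1) =
      Matrix.diagonal t + (1 - Real.log Z) • (1 : Mat m) := by
    ext i j
    rcases eq_or_ne i j with rfl | hij
    · simp [hv, Real.log_div (Real.exp_pos _).ne' hZ0.ne']; ring
    · simp [hij]
  have h2 : P * Matrix.diagonal (fun i => Real.log (v i) + 1) * Pᵀ =
      Θ + (1 - Real.log Z) • (1 : Mat m) := by
    rw [h1, Matrix.mul_add, Matrix.add_mul, ← h.eq]
    simp [h.mul_transpose]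
  -- The gradient at the Gibbs state is `Θ` plus a multiple of the identity, which is invisible on
  -- differences of trace-one matrices.
  have h3 : traceForm (P * Matrix.diagonal (fun i => Real.log (v i) + 1) * Pᵀ) (W - V) =
      traceForm Θ W - traceForm Θ V := by
    rw [h2, traceForm_apply, Matrix.add_mul, Matrix.trace_add, Matrix.smul_mul, Matrix.one_mul,
      Matrix.trace_smul, Submodule.coe_sub, Matrix.trace_sub, hW.1.2, htr, sub_self, smul_zero,
      add_zero, Matrix.mul_sub, Matrix.trace_sub, traceForm_apply, traceForm_apply]
  rw [h3]
  ring

end Entropy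

/-! ### Nets for Bregman balls in both setups -/

section Nets

variable {n m : ℕ} {A : Fin n → Mat m}

/-- Subtracting the gradient form at `U₀` changes the entropy into the divergence from `U₀` up to a
constant. The divergence ball becomes a sublevel set, and tilting by measurements only changes the
matrix `Θ` of the Gibbs state. -/
theorem exists_entropy_net (hn : 0 < n) (hA : ∀ i, (A i).IsSymm)
    (hA1 : ∀ i, dualNorm (schattenNorm 1) (A i) ≤ 1) (D : ℝ) {U₀ : SymMat m}
    (hU₀ : U₀ ∈ spectraplex m ∩ posDefMatrices m) :
    ∃ Z : Set (Fin n → ℝ), Z.encard ≤ 2 ^ (12 * n) ∧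
      ∀ U ∈ spectraplex m ∩ posDefMatrices m, bregman entropyMirrorMap U U₀ ≤ D →
        ∃ z ∈ Z, ∀ i, |measurementMap A (U : Mat m) i - z i| ≤ √(D / n) := by
  obtain ⟨U, x, h⟩ := exists_spectralDecomp (isSymm_coe U₀)
  have hx : ∀ i, 0 < x i := h.posDef_iff.1 hU₀.2
  have hm : Nonempty (Fin m) := by
    by_contra hne
    rw [not_nonempty_iff] at hne
    have := hU₀.1.2
    simp [Matrix.trace] at this
  set Θ₀ := U * Matrix.diagonal (fun i => Real.log (x i) + 1) * Uᵀ with hΘ₀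
  have hb : ∀ W, bregman entropyMirrorMap W U₀ =
      (entropyMirrorMap W - traceForm Θ₀ W) - (entropyMirrorMap U₀ - traceForm Θ₀ U₀) := by
    intro W
    rw [h.bregman_entropyMirrorMap hx, map_sub]; ring
  obtain ⟨Z, hZ, hcov⟩ := exists_small_net hn (fun i (W : SymMat m) => traceInner (A i) W)
    (fun W => entropyMirrorMap W - traceForm Θ₀ W) (spectraplex m ∩ posDefMatrices m) D
    (fun k => by
      have hΘ : (Θ₀ + ∑ j, k j • A j).IsSymm := by
        have h1 : Θ₀.IsSymm := (h.mk' _).isSymm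
        rw [Matrix.IsSymm, Matrix.transpose_add, Matrix.transpose_sum, h1.eq]
        simp only [Matrix.transpose_smul, (hA _).eq]
      obtain ⟨V, hV, hmin⟩ := exists_entropyMirrorMap_minimizer hm hΘ
      have hsum : ∀ W : SymMat m, traceForm (Θ₀ + ∑ j, k j • A j) W =
          traceForm Θ₀ W + ∑ j, k j * traceInner (A j) W := by
        intro W
        rw [traceForm_apply, Matrix.add_mul, Matrix.trace_add, Finset.sum_mul, Matrix.trace_sum,
          traceForm_apply]
        congr 1
        refine Finset.sum_congr rfl fun j _ => ?_
        rw [Matrix.smul_mul, Matrix.trace_smul, traceInner, (hA j).eq, smul_eq_mul]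
      refine ⟨V, hV, fun W hW i => ?_⟩
      refine (bregman_entropyMirrorMap_ge (hA i) (hA1 i) hW hV).trans (le_of_eq ?_)
      rw [hmin W hW, hsum, hsum]
      ring)
    -- Nonnegativity of the divergence is read off from strong convexity tested on one of the `A i`;
    -- this needs `0 < n`.
    U₀ (fun W hW => by
      have := bregman_entropyMirrorMap_ge (hA ⟨0, hn⟩) (hA1 ⟨0, hn⟩) hW hU₀
      rw [hb] at this
      nlinarith [sq_nonneg (traceInner (A ⟨0, hn⟩) W - traceInner (A ⟨0, hn⟩) U₀)])
  exact ⟨Z, hZ, fun W hW hD => hcov W hW (by rwa [← hb])⟩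

theorem exists_schatten_net (hn : 0 < n) (hA : ∀ i, (A i).IsSymm) {p : ℝ} (hp : 1 < p)
    (hp2 : p ≤ 2) (hA1 : ∀ i, dualNorm (schattenNorm p) (A i) ≤ 1) (D : ℝ) (U₀ : Mat m) :
    ∃ Z : Set (Fin n → ℝ), Z.encard ≤ 2 ^ (12 * n) ∧
      ∀ U, bregman (schattenMirrorMap p) U U₀ ≤ D →
        ∃ z ∈ Z, ∀ i, |measurementMap A U i - z i| ≤ √(D / n) := by
  set L := fderiv ℝ (schattenMirrorMap p) U₀ with hL
  have hb : ∀ W, bregman (schattenMirrorMap p) W U₀ =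
      (schattenMirrorMap p W - L W) - (schattenMirrorMap p U₀ - L U₀) := by
    intro W
    rw [bregman, ← hL, map_sub]; ring
  let a : Fin n → Mat m →ₗ[ℝ] ℝ := fun i =>
    { toFun := fun W => traceInner (A i) W
      map_add' := fun H K => by simp only [traceInner, Matrix.mul_add, Matrix.trace_add]
      map_smul' := fun t H => traceInner_smul _ _ _ }
  obtain ⟨Z, hZ, hcov⟩ := exists_small_net hn (fun i W => traceInner (A i) W)
    (fun W => schattenMirrorMap p W - L W) Set.univ D
    (fun k => by
      obtain ⟨V, hmin⟩ := exists_schattenMirrorMap_minimizer hp hp2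
        (L + LinearMap.toContinuousLinearMap (∑ j, k j • a j))
      have hsum : ∀ W, (L + LinearMap.toContinuousLinearMap (∑ j, k j • a j)) W =
          L W + ∑ j, k j * traceInner (A j) W := by
        intro W
        simp [a]
        rfl
      refine ⟨V, Set.mem_univ _, fun W _ i => ?_⟩
      refine (bregman_schattenMirrorMap_ge hp hp2 (hA i) (hA1 i) W V).trans (le_of_eq ?_)
      rw [hmin W, hsum, hsum]
      ring)
    U₀ (fun W _ => by
      have := bregman_schattenMirrorMap_ge hp hp2 (hA ⟨0, hn⟩) (hA1 ⟨0, hn⟩) W U₀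
      rw [hb] at this
      nlinarith [sq_nonneg (traceInner (A ⟨0, hn⟩) W - traceInner (A ⟨0, hn⟩) U₀)])
  exact ⟨Z, hZ, fun W hD => hcov W (Set.mem_univ _) (by rwa [← hb])⟩

end Nets

end MirrorCover

end

theorem mainTheorem7 :
    ∀ C₀ : ℕ, ∃ C : ℕ, ∀ (n m : ℕ), 0 < n →
      ∀ A : Fin n → MirrorCover.Mat m, (∀ i, (A i).IsSymm) →
      -- the spectraplex setup
      ((∀ i, MirrorCover.dualNorm (MirrorCover.schattenNorm 1) (A i) ≤ 1) →
        ∀ (T₀ T' : Set (MirrorCover.SymMat m)) (Dmax : ℝ),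
          T₀ ⊆ MirrorCover.spectraplex m ∩ MirrorCover.posDefMatrices m →
          T' ⊆ MirrorCover.spectraplex m ∩ MirrorCover.posDefMatrices m →
          T₀.encard ≤ 2 ^ (C₀ * n) →
          (∀ U ∈ T', ∃ U₀ ∈ T₀,
            MirrorCover.bregman MirrorCover.entropyMirrorMap U U₀ ≤ Dmax) →
          MirrorCover.coveringNumber
              ((fun U : MirrorCover.SymMat m =>
                MirrorCover.measurementMap A (U : MirrorCover.Mat m)) '' T')
              (√(Dmax / n) • MirrorCover.unitCube n)
            ≤ 2 ^ (C * n)) ∧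
      -- the Schatten norm setup
      (∀ p : ℝ, 1 < p → p ≤ 2 →
        (∀ i, MirrorCover.dualNorm (MirrorCover.schattenNorm p) (A i) ≤ 1) →
        ∀ (T₀ T' : Set (MirrorCover.Mat m)) (Dmax : ℝ),
          T₀.encard ≤ 2 ^ (C₀ * n) →
          (∀ U ∈ T', ∃ U₀ ∈ T₀,
            MirrorCover.bregman (MirrorCover.schattenMirrorMap p) U U₀ ≤ Dmax) →
          MirrorCover.coveringNumber
              (MirrorCover.measurementMap A '' T')
              (√(Dmax / n) • MirrorCover.unitCube n)
            ≤ 2 ^ (C * n)) := by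
  intro C₀
  refine ⟨C₀ + 12, fun n m hn A hA => ⟨?_, ?_⟩⟩
  · intro hA1 T₀ T' D hT₀ hT' hcard hdiv
    refine MirrorCover.coveringNumber_image_le _ T₀ T' D
      (MirrorCover.bregman MirrorCover.entropyMirrorMap) hcard hdiv fun U₀ hU₀ => ?_
    obtain ⟨Z, hZ, hcov⟩ := MirrorCover.exists_entropy_net hn hA hA1 D (hT₀ hU₀)
    exact ⟨Z, hZ, fun U hU => hcov U (hT' hU)⟩
  · intro p hp hp2 hA1 T₀ T' D hcard hdiv
    refine MirrorCover.coveringNumber_image_le _ T₀ T' D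
      (MirrorCover.bregman (MirrorCover.schattenMirrorMap p)) hcard hdiv fun U₀ _ => ?_
    obtain ⟨Z, hZ, hcov⟩ := MirrorCover.exists_schatten_net hn hA hp hp2 hA1 D U₀
    exact ⟨Z, hZ, fun U _ => hcov U⟩
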